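/- Let packets of size $L_p>0$ arrive one per block at a FIFO buffer of infinite length, packet $n$ $(n\ge 0)$ arriving at epoch $n$ (time is measured in blocks). Let $\nu>0$, $\theta=L_p/\nu$, and assume $\theta<1$. For each packet $n$ let $s_{n,0},s_{n,1},\dots$ be the services (amounts of data) that the successive blocks met by packet $n$ can provide; all the $s_{n,j}$ are independent and exponentially distributed with mean $\nu$ (a block partly consumed by an earlier packet is counted as a new block for the next one). Put $S_{n,k}=\sum_{j<k}s_{n,j}$ and define for packet $n$ - the service time $T_n=\min\{k\ge 0: S_{n,k+1}>L_p\}$, the number of complete blocks used; - the vestige time $V_n=(L_p-S_{n,T_n})/s_{n,T_n}$, the fraction of the final block used; - the waiting time $W_n=\beta_n-n$, where $\beta_n$ is the epoch at which its service starts: $\beta_0=w_0$ and $\beta_{n+1}=\max(n+1,\ \beta_n+T_n)$, with an initial backlog $w_0\in\{0,1,2,\dots\}$ that is random and independent of all $s_{n,j}$; - the packet delay $D_n=T_n+W_n+V_n$. Then there is a probability distribution $\pi$ on $\{0,1,2,\dots\}$, depending only on $L_p$ and $\nu$, such that: 1. for every initial backlog $w_0$ the law of $W_n$ converges to $\pi$,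 i.e. $\Pr\{W_n=j\}\to\pi(\{j\})$ for every $j$; 2. (steady state) if $w_0$ has law $\pi$, then for every $n$ the waiting time $W_n$ has law $\pi$, the variables $T_n+W_n$, $V_n$ and $D_n$ are integrable, and $$\mathsf E[T_n+W_n]=\theta+\frac{\theta^2}{2(1-\theta)},\qquad \mathsf E[V_n]=\frac12+\int_0^1(x-1)e^{-\theta/x}\,dx,$$ $$\mathsf E[D_n]=\frac12+\theta+\frac{\theta^2}{2(1-\theta)}+\int_0^1(x-1)e^{-\theta/x}\,dx;$$ 3. if $w_0$ has finite mean, then every $D_n$ is integrable and $$\lim_{n\to\infty}\mathsf E[D_n]=\frac12+\theta+\frac{\theta^2}{2(1-\theta)}+\int_0^1(x-1)e^{-\theta/x}\,dx .$$ -/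

import Mathlib

open MeasureTheory ProbabilityTheory Filter Topology

universe u

namespace BlockFading

noncomputable section

/-- `S_k`: the amount of service provided by the first `k` blocks, when the successive blocks
provide the services `s 0, s 1, …`. -/
def cumService (s : ℕ → ℝ) (k : ℕ) : ℝ := ∑ j ∈ Finset.range k, s j

/-- Service time `T` of a packet of size `L` whose service starts at the beginning of a block:
the number of complete blocks that it uses, that is the first `k` with `S_{k+1} > L`. -/
def serviceTime (L : ℝ) (s : ℕ → ℝ) : ℕ := sInf {k : ℕ | L < cumService s (k + 1)}

/-- Vestige time `V`: the fraction of the final block needed to transmit the part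
`L - S_T` of the packet that remains after the `T` complete blocks. -/
def vestigeTime (L : ℝ) (s : ℕ → ℝ) : ℝ :=
  (L - cumService s (serviceTime L s)) / s (serviceTime L s)

/-- FIFO with one arrival per block: packet `n` arrives at epoch `n`. Given the service times
`T n`, packet `n + 1` starts its service at its arrival or at the departure of packet `n`,
whichever is later; packet `0` finds a backlog of `w₀` blocks. -/
def startEpoch (T : ℕ → ℕ) (w₀ : ℕ) : ℕ → ℕ
  | 0 => w₀
  | n + 1 => max (n + 1) (startEpoch T w₀ n + T n)

/-- Waiting time of packet `n`: from its arrival to the start of its service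
(the start is never before the arrival, so the subtraction is exact). -/
def waitingTime (T : ℕ → ℕ) (w₀ n : ℕ) : ℕ := startEpoch T w₀ n - n

theorem le_startEpoch (T : ℕ → ℕ) (w₀ n : ℕ) : n ≤ startEpoch T w₀ n := by
  cases n with
  | zero => exact Nat.zero_le _
  | succ n => exact le_max_left _ _

variable {Ω : Type*}

/-- Service time `T_n` of packet `n`; `s n j` is the service that the `j`-th block met by
packet `n` can provide. -/
def T (L : ℝ) (s : ℕ → ℕ → Ω → ℝ) (n : ℕ) (ω : Ω) : ℕ :=
  serviceTime L (fun j => s n j ω)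

/-- Vestige time `V_n` of packet `n`. -/
def V (L : ℝ) (s : ℕ → ℕ → Ω → ℝ) (n : ℕ) (ω : Ω) : ℝ :=
  vestigeTime L (fun j => s n j ω)

/-- Waiting time `W_n` of packet `n`. -/
def W (L : ℝ) (s : ℕ → ℕ → Ω → ℝ) (w₀ : Ω → ℕ) (n : ℕ) (ω : Ω) : ℕ :=
  waitingTime (fun m => T L s m ω) (w₀ ω) n

/-- Packet delay `D_n = T_n + W_n + V_n`, in blocks. -/
def D (L : ℝ) (s : ℕ → ℕ → Ω → ℝ) (w₀ : Ω → ℕ) (n : ℕ) (ω : Ω) : ℝ :=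
  (T L s n ω : ℝ) + (W L s w₀ n ω : ℝ) + V L s n ω

/-- The probabilistic assumptions: the services `s n j` of the blocks met by the packets are
independent and exponentially distributed with mean `ν` (a block of which a part was consumed by
an earlier packet counts as a new block), and the backlog `w₀` found by packet `0` is
independent of them. -/
structure IsModel [MeasurableSpace Ω] (P : Measure Ω) (ν : ℝ)
    (s : ℕ → ℕ → Ω → ℝ) (w₀ : Ω → ℕ) : Prop where
  measurable_service : ∀ n j, Measurable (s n j)
  law_service : ∀ n j, P.map (s n j) = expMeasure ν⁻¹
  indep_service : iIndepFun (fun p : ℕ × ℕ => s p.1 p.2) P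
  measurable_init : Measurable w₀
  indep_init : IndepFun w₀ (fun ω (p : ℕ × ℕ) => s p.1 p.2 ω) P

end

end BlockFading

namespace BlockFading

open scoped ENNReal NNReal Nat

/-! Counting renewals of exponential services inside `L` shows that `T_n` is Poisson with mean `θ =
L/ν` (`map_serviceTime`). Waiting times obey Lindley's recursion `W_{n+1} = (W_n + T_n - 1)⁺` with
`T_n` independent of `W_n`, so their laws are the orbit of `queueStep` for this Poisson law.

For a queue started empty, the laws increase stochastically. Expanding the first three moments of
one step gives recursions in which truncation enters only through the idle probability. Since each
moment increases, the second recursion bounds the mean and the third bounds the second moment. Hence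
both converge, and the limiting recursions give the Pollaczek–Khinchine mean
(`tendsto_mean_queueLaw`). Bounded means prevent escape of mass, so the laws converge to some `π`,
which is invariant and has the limiting mean (`exists_steadyState`).

An arbitrary initial backlog is coupled with the empty start through the same services. Until the
two paths merge the server is never idle, which the law of large numbers rules out in the long run
because `θ < 1`. They therefore merge almost surely, and dominated convergence transfers laws and,
when `w₀` has finite mean, means (`tendsto_integral_W_sub`).

For the vestige time, one conditions on the service `S_k = y` already received. The Erlang densities
of all `S_k`, `k ≥ 1`, add up to the constant rate, so the tail of `V_n` becomes an elementary
integral (`measureReal_lt_vestigeTime`). Integrating the tail gives its mean. -/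

/-- Law of `(w + t - 1)⁺` when `w` and `t` are independent with laws `μ` and `τ`. -/
noncomputable def queueStep (τ μ : Measure ℕ) : Measure ℕ :=
  (μ.prod τ).map (fun p => p.1 + p.2 - 1)

/-- Law of the waiting time of packet `n` when packet `0` finds an empty queue and the service
times are independent with law `τ`. -/
noncomputable def queueLaw (τ : Measure ℕ) (n : ℕ) : Measure ℕ :=
  (queueStep τ)^[n] (Measure.dirac 0)

/-! ### Lindley recursion: stochastic order and moments -/

section Queue

variable {τ μ μ' : Measure ℕ}

theorem lintegral_queueStep (f : ℕ → ℝ≥0∞) :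
    ∫⁻ w, f w ∂queueStep τ μ = ∫⁻ w, ∫⁻ t, f (w + t - 1) ∂τ ∂μ := by
  rw [queueStep, lintegral_map Measurable.of_discrete Measurable.of_discrete,
    lintegral_prod _ Measurable.of_discrete.aemeasurable]

/-- Probability that the queue is empty at the end of a step. -/
noncomputable def idleProb (τ μ : Measure ℕ) : ℝ :=
  ∫ p : ℕ × ℕ, (if p.1 + p.2 = 0 then 1 else 0 : ℝ) ∂(μ.prod τ)

theorem idleProb_nonneg : 0 ≤ idleProb τ μ :=
  integral_nonneg fun p => by dsimp only [Pi.zero_apply]; split_ifs <;> simp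

theorem integral_pow_queueStep (k : ℕ) :
    ∫ w, (w : ℝ) ^ k ∂queueStep τ μ = ∫ p : ℕ × ℕ, ((p.1 + p.2 - 1 : ℕ) : ℝ) ^ k ∂μ.prod τ := by
  rw [queueStep, integral_map Measurable.of_discrete.aemeasurable
    AEStronglyMeasurable.of_discrete]

theorem integral_pow_mul_pow (i j : ℕ) :
    ∫ p : ℕ × ℕ, (p.1 : ℝ) ^ i * ((p.2 : ℝ) - 1) ^ j ∂(μ.prod τ) =
      (∫ w, (w : ℝ) ^ i ∂μ) * ∫ t, ((t : ℝ) - 1) ^ j ∂τ :=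
  integral_prod_mul (fun w : ℕ => (w : ℝ) ^ i) (fun t : ℕ => ((t : ℝ) - 1) ^ j)

/-- The usual stochastic order on measures on `ℕ`. -/
def StochLE (μ μ' : Measure ℕ) : Prop :=
  ∀ f : ℕ → ℝ≥0∞, Monotone f → ∫⁻ w, f w ∂μ ≤ ∫⁻ w, f w ∂μ'

theorem StochLE.queueStep  (h : StochLE μ μ') :
    StochLE (queueStep τ μ) (queueStep τ μ') := by
  intro f hf
  rw [lintegral_queueStep, lintegral_queueStep]
  refine h _ fun a b hab => lintegral_mono fun t => hf ?_
  omega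

variable [IsProbabilityMeasure τ]

theorem queueLaw_succ (τ : Measure ℕ) (n : ℕ) :
    queueLaw τ (n + 1) = queueStep τ (queueLaw τ n) :=
  Function.iterate_succ_apply' _ _ _

instance isProbabilityMeasure_queueStep [IsProbabilityMeasure μ] :
    IsProbabilityMeasure (queueStep τ μ) :=
  Measure.isProbabilityMeasure_map Measurable.of_discrete.aemeasurable

instance isProbabilityMeasure_queueLaw (n : ℕ) : IsProbabilityMeasure (queueLaw τ n) := by
  induction n with
  | zero => exact inferInstanceAs (IsProbabilityMeasure (Measure.dirac 0))
  | succ n ih => rw [queueLaw_succ]; infer_instance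

theorem stochLE_dirac_zero [IsProbabilityMeasure μ] : StochLE (Measure.dirac 0) μ := by
  intro f hf
  rw [lintegral_dirac]
  calc f 0 = ∫⁻ _, f 0 ∂μ := by simp
    _ ≤ ∫⁻ w, f w ∂μ := lintegral_mono fun w => hf (Nat.zero_le w)

/-- The empty state is the smallest law and a step preserves the order, so the first comparison
propagates. -/
theorem stochLE_queueLaw_succ (n : ℕ) : StochLE (queueLaw τ n) (queueLaw τ (n + 1)) := by
  induction n with
  | zero => exact stochLE_dirac_zero
  | succ n ih => rw [queueLaw_succ τ n, queueLaw_succ τ (n + 1)]; exact ih.queueStep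

theorem StochLE.integral_pow_le (h : StochLE μ μ') (k : ℕ)
    (hi : Integrable (fun w : ℕ => (w : ℝ) ^ k) μ') :
    ∫ w, (w : ℝ) ^ k ∂μ ≤ ∫ w, (w : ℝ) ^ k ∂μ' := by
  have hnn : ∀ w : ℕ, 0 ≤ (w : ℝ) ^ k := fun w => by positivity
  rw [integral_eq_lintegral_of_nonneg_ae (ae_of_all _ hnn) AEStronglyMeasurable.of_discrete,
    integral_eq_lintegral_of_nonneg_ae (ae_of_all _ hnn) AEStronglyMeasurable.of_discrete]
  refine ENNReal.toReal_mono hi.lintegral_lt_top.ne (h _ fun a b hab => ?_)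
  exact ENNReal.ofReal_le_ofReal (by gcongr)

theorem memLp_queueStep [IsProbabilityMeasure μ] {p : ℝ≥0∞}
    (hτ : MemLp (fun t : ℕ => (t : ℝ)) p τ) (hμ : MemLp (fun w : ℕ => (w : ℝ)) p μ) :
    MemLp (fun w : ℕ => (w : ℝ)) p (queueStep τ μ) := by
  rw [queueStep, memLp_map_measure_iff AEStronglyMeasurable.of_discrete
    Measurable.of_discrete.aemeasurable]
  refine ((hμ.comp_fst τ).add (hτ.comp_snd μ)).mono AEStronglyMeasurable.of_discrete
    (ae_of_all _ fun q => ?_)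
  simp only [Function.comp, Pi.add_apply, Real.norm_eq_abs, Nat.abs_cast]
  rw [abs_of_nonneg (by positivity)]
  exact_mod_cast Nat.sub_le _ _

theorem memLp_queueLaw {p : ℝ≥0∞} (hτ : MemLp (fun t : ℕ => (t : ℝ)) p τ) (n : ℕ) :
    MemLp (fun w : ℕ => (w : ℝ)) p (queueLaw τ n) := by
  induction n with
  | zero =>
    refine MemLp.of_bound (C := 0) AEStronglyMeasurable.of_discrete ?_
    simp [queueLaw, ae_dirac_eq]
  | succ n ih => rw [queueLaw_succ]; exact memLp_queueStep hτ ih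

theorem integrable_idle [IsProbabilityMeasure μ] :
    Integrable (fun p : ℕ × ℕ => (if p.1 + p.2 = 0 then 1 else 0 : ℝ)) (μ.prod τ) := by
  refine Integrable.of_bound AEStronglyMeasurable.of_discrete 1 (ae_of_all _ fun p => ?_)
  split_ifs <;> simp

theorem idleProb_le_one [IsProbabilityMeasure μ] : idleProb τ μ ≤ 1 := by
  calc idleProb τ μ ≤ ∫ _, (1 : ℝ) ∂(μ.prod τ) :=
        integral_mono integrable_idle (integrable_const _) fun p => by
          dsimp only; split_ifs <;> simp
    _ = 1 := by simp

theorem integrable_pow_of_memLp_three [IsFiniteMeasure μ] {f : ℕ → ℝ}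
    (h : MemLp f 3 μ) {k : ℕ} (hk : k ≤ 3) : Integrable (fun w => f w ^ k) μ := by
  have h1 : MemLp f k μ := h.mono_exponent (by exact_mod_cast hk)
  have := h1.integrable_norm_pow' 
  refine this.mono AEStronglyMeasurable.of_discrete (ae_of_all _ fun w => ?_)
  simp

/-- Truncation acts only at `a = b = 0`, where it replaces `-1` by `0`. In a `k`-th power the
correction is therefore `0 ^ k - (-1) ^ k`, which explains the alternating sign of `idleProb` in the
moment recursions below. -/
theorem cast_add_sub_one (a b : ℕ) :
    ((a + b - 1 : ℕ) : ℝ) = a + (b - 1) + if a + b = 0 then 1 else 0 := by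
  split_ifs with h
  · obtain ⟨rfl, rfl⟩ : a = 0 ∧ b = 0 := by omega
    simp
  · rw [Nat.cast_sub (by omega)]; push_cast; ring

theorem memLp_sub_one {p : ℝ≥0∞} (hτ : MemLp (fun t : ℕ => (t : ℝ)) p τ) :
    MemLp (fun t : ℕ => (t : ℝ) - 1) p τ :=
  hτ.sub (memLp_const 1)

theorem integrable_pow_mul_pow [IsProbabilityMeasure μ]
    (hτ : MemLp (fun t : ℕ => (t : ℝ)) 3 τ) (hμ : MemLp (fun w : ℕ => (w : ℝ)) 3 μ)
    {i j : ℕ} (hi : i ≤ 3) (hj : j ≤ 3) :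
    Integrable (fun p : ℕ × ℕ => (p.1 : ℝ) ^ i * ((p.2 : ℝ) - 1) ^ j) (μ.prod τ) :=
  (integrable_pow_of_memLp_three hμ hi).mul_prod
    (integrable_pow_of_memLp_three (memLp_sub_one hτ) hj)

theorem integral_pow_one_queueStep [IsProbabilityMeasure μ]
    (hτ : MemLp (fun t : ℕ => (t : ℝ)) 3 τ) (hμ : MemLp (fun w : ℕ => (w : ℝ)) 3 μ) :
    ∫ w, (w : ℝ) ^ 1 ∂queueStep τ μ =
      ∫ w, (w : ℝ) ^ 1 ∂μ + ∫ t, ((t : ℝ) - 1) ^ 1 ∂τ + idleProb τ μ := by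
  have h10 := integrable_pow_mul_pow hτ hμ (i := 1) (j := 0) (by norm_num) (by norm_num)
  have h01 := integrable_pow_mul_pow hτ hμ (i := 0) (j := 1) (by norm_num) (by norm_num)
  have e10 := integral_pow_mul_pow (μ := μ) (τ := τ) 1 0
  have e01 := integral_pow_mul_pow (μ := μ) (τ := τ) 0 1
  rw [integral_pow_queueStep]
  have : ∀ p : ℕ × ℕ, ((p.1 + p.2 - 1 : ℕ) : ℝ) ^ 1 =
      (p.1 : ℝ) ^ 1 * ((p.2 : ℝ) - 1) ^ 0 + (p.1 : ℝ) ^ 0 * ((p.2 : ℝ) - 1) ^ 1 +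
        if p.1 + p.2 = 0 then 1 else 0 := fun p => by
    rw [cast_add_sub_one]; ring
  simp_rw [this]
  rw [integral_add (h10.fun_add h01) integrable_idle, integral_add h10 h01, e10, e01, idleProb]
  simp

theorem integral_pow_two_queueStep [IsProbabilityMeasure μ]
    (hτ : MemLp (fun t : ℕ => (t : ℝ)) 3 τ) (hμ : MemLp (fun w : ℕ => (w : ℝ)) 3 μ) :
    ∫ w, (w : ℝ) ^ 2 ∂queueStep τ μ =
      ∫ w, (w : ℝ) ^ 2 ∂μ + 2 * (∫ w, (w : ℝ) ^ 1 ∂μ) * (∫ t, ((t : ℝ) - 1) ^ 1 ∂τ)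
        + ∫ t, ((t : ℝ) - 1) ^ 2 ∂τ - idleProb τ μ := by
  have h20 := integrable_pow_mul_pow hτ hμ (i := 2) (j := 0) (by norm_num) (by norm_num)
  have h11 := integrable_pow_mul_pow hτ hμ (i := 1) (j := 1) (by norm_num) (by norm_num)
  have h02 := integrable_pow_mul_pow hτ hμ (i := 0) (j := 2) (by norm_num) (by norm_num)
  have e20 := integral_pow_mul_pow (μ := μ) (τ := τ) 2 0
  have e11 := integral_pow_mul_pow (μ := μ) (τ := τ) 1 1
  have e02 := integral_pow_mul_pow (μ := μ) (τ := τ) 0 2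
  rw [integral_pow_queueStep]
  have : ∀ p : ℕ × ℕ, ((p.1 + p.2 - 1 : ℕ) : ℝ) ^ 2 =
      (p.1 : ℝ) ^ 2 * ((p.2 : ℝ) - 1) ^ 0 + 2 * ((p.1 : ℝ) ^ 1 * ((p.2 : ℝ) - 1) ^ 1)
        + (p.1 : ℝ) ^ 0 * ((p.2 : ℝ) - 1) ^ 2 - if p.1 + p.2 = 0 then 1 else 0 := fun p => by
    rw [cast_add_sub_one]
    split_ifs with h
    · obtain ⟨h1, h2⟩ : p.1 = 0 ∧ p.2 = 0 := by omega
      simp [h1, h2]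
    · ring
  simp_rw [this]
  rw [integral_sub ((h20.fun_add (h11.const_mul 2)).fun_add h02) integrable_idle,
    integral_add (h20.fun_add (h11.const_mul 2)) h02, integral_add h20 (h11.const_mul 2),
    integral_const_mul, e20, e11, e02, idleProb]
  simp [mul_assoc]

theorem integral_pow_three_queueStep [IsProbabilityMeasure μ]
    (hτ : MemLp (fun t : ℕ => (t : ℝ)) 3 τ) (hμ : MemLp (fun w : ℕ => (w : ℝ)) 3 μ) :
    ∫ w, (w : ℝ) ^ 3 ∂queueStep τ μ =
      ∫ w, (w : ℝ) ^ 3 ∂μ + 3 * (∫ w, (w : ℝ) ^ 2 ∂μ) * (∫ t, ((t : ℝ) - 1) ^ 1 ∂τ)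
        + 3 * (∫ w, (w : ℝ) ^ 1 ∂μ) * (∫ t, ((t : ℝ) - 1) ^ 2 ∂τ)
        + ∫ t, ((t : ℝ) - 1) ^ 3 ∂τ + idleProb τ μ := by
  have h30 := integrable_pow_mul_pow hτ hμ (i := 3) (j := 0) (by norm_num) (by norm_num)
  have h21 := integrable_pow_mul_pow hτ hμ (i := 2) (j := 1) (by norm_num) (by norm_num)
  have h12 := integrable_pow_mul_pow hτ hμ (i := 1) (j := 2) (by norm_num) (by norm_num)
  have h03 := integrable_pow_mul_pow hτ hμ (i := 0) (j := 3) (by norm_num) (by norm_num)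
  have e30 := integral_pow_mul_pow (μ := μ) (τ := τ) 3 0
  have e21 := integral_pow_mul_pow (μ := μ) (τ := τ) 2 1
  have e12 := integral_pow_mul_pow (μ := μ) (τ := τ) 1 2
  have e03 := integral_pow_mul_pow (μ := μ) (τ := τ) 0 3
  rw [integral_pow_queueStep]
  have : ∀ p : ℕ × ℕ, ((p.1 + p.2 - 1 : ℕ) : ℝ) ^ 3 =
      (p.1 : ℝ) ^ 3 * ((p.2 : ℝ) - 1) ^ 0 + 3 * ((p.1 : ℝ) ^ 2 * ((p.2 : ℝ) - 1) ^ 1)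
        + 3 * ((p.1 : ℝ) ^ 1 * ((p.2 : ℝ) - 1) ^ 2)
        + (p.1 : ℝ) ^ 0 * ((p.2 : ℝ) - 1) ^ 3 + if p.1 + p.2 = 0 then 1 else 0 := fun p => by
    rw [cast_add_sub_one]
    split_ifs with h
    · obtain ⟨h1, h2⟩ : p.1 = 0 ∧ p.2 = 0 := by omega
      norm_num [h1, h2]
    · ring
  simp_rw [this]
  rw [integral_add (((h30.fun_add (h21.const_mul 3)).fun_add (h12.const_mul 3)).fun_add h03)
      integrable_idle,
    integral_add ((h30.fun_add (h21.const_mul 3)).fun_add (h12.const_mul 3)) h03,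
    integral_add (h30.fun_add (h21.const_mul 3)) (h12.const_mul 3),
    integral_add h30 (h21.const_mul 3),
    integral_const_mul, integral_const_mul, e30, e21, e12, e03, idleProb]
  simp [mul_assoc]

/-- A stable queue started empty has mean waiting times that converge to the
Pollaczek–Khinchine value. -/
theorem tendsto_mean_queueLaw (hτ : MemLp (fun t : ℕ => (t : ℝ)) 3 τ)
    {a b : ℝ} (ha : ∫ t, ((t : ℝ) - 1) ^ 1 ∂τ = -a) (ha0 : 0 < a)
    (hb : ∫ t, ((t : ℝ) - 1) ^ 2 ∂τ = b) :
    Monotone (fun n => ∫ w, (w : ℝ) ^ 1 ∂queueLaw τ n) ∧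
    Tendsto (fun n => ∫ w, (w : ℝ) ^ 1 ∂queueLaw τ n) atTop (𝓝 ((b - a) / (2 * a))) := by
  set c := ∫ t, ((t : ℝ) - 1) ^ 3 ∂τ
  set M : ℕ → ℕ → ℝ := fun k n => ∫ w, (w : ℝ) ^ k ∂queueLaw τ n with hM
  set q : ℕ → ℝ := fun n => idleProb τ (queueLaw τ n) with hq
  have hmono : ∀ k ≤ 3, Monotone (M k) := fun k hk => monotone_nat_of_le_succ fun n =>
    (stochLE_queueLaw_succ n).integral_pow_le k
      (integrable_pow_of_memLp_three (memLp_queueLaw hτ _) hk)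
  have r1 : ∀ n, M 1 (n + 1) = M 1 n - a + q n := fun n => by
    simp only [hM, hq, queueLaw_succ]
    rw [integral_pow_one_queueStep hτ (memLp_queueLaw hτ n), ha]; ring
  have r2 : ∀ n, M 2 (n + 1) = M 2 n - 2 * a * M 1 n + b - q n := fun n => by
    simp only [hM, hq, queueLaw_succ]
    rw [integral_pow_two_queueStep hτ (memLp_queueLaw hτ n), ha, hb]; ring
  have r3 : ∀ n, M 3 (n + 1) = M 3 n - 3 * a * M 2 n + 3 * b * M 1 n + c + q n := fun n => by
    simp only [hM, hq, queueLaw_succ]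
    rw [integral_pow_three_queueStep hτ (memLp_queueLaw hτ n), ha, hb]; ring
  have hq0 : ∀ n, 0 ≤ q n := fun n => idleProb_nonneg
  have hq1 : ∀ n, q n ≤ 1 := fun n => idleProb_le_one
  have hb0 : 0 ≤ b := hb ▸ integral_nonneg fun t => by positivity
  -- As `M 2` increases, `r2` forces `2 * a * M 1 n ≤ b - q n`.
  have b1 : ∀ n, M 1 n ≤ b / (2 * a) := fun n => by
    rw [le_div_iff₀ (by positivity)]
    linarith [hmono 2 (by norm_num) n.le_succ, r2 n, hq0 n]
  -- The same argument one order higher; this is why third moments are needed.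
  have b2 : ∀ n, M 2 n ≤ (3 * b * (b / (2 * a)) + c + 1) / (3 * a) := fun n => by
    rw [le_div_iff₀ (by positivity)]
    have := mul_le_mul_of_nonneg_left (b1 n) (by positivity : 0 ≤ 3 * b)
    linarith [hmono 3 (by norm_num) n.le_succ, r3 n, hq1 n]
  have t1 := tendsto_atTop_ciSup (hmono 1 (by norm_num)) ⟨_, Set.forall_mem_range.2 b1⟩
  have t2 := tendsto_atTop_ciSup (hmono 2 (by norm_num)) ⟨_, Set.forall_mem_range.2 b2⟩
  -- The increments of the convergent sequence `M 1` vanish in `r1`.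
  have tq : Tendsto q atTop (𝓝 a) := by
    have := ((t1.comp (tendsto_add_atTop_nat 1)).sub t1).add_const a
    rw [sub_self, zero_add] at this
    refine this.congr fun n => ?_
    simp only [Function.comp, r1]; ring
  -- `r2` solved for `M 1`; the increments of `M 2` vanish as well.
  have td : Tendsto (M 1) atTop (𝓝 ((b - a) / (2 * a))) := by
    have := ((tq.const_sub b).sub ((t2.comp (tendsto_add_atTop_nat 1)).sub t2)).div_const (2 * a)
    rw [sub_self, sub_zero] at this
    refine this.congr fun n => ?_
    simp only [Function.comp, r2]; field_simp; ring
  exact ⟨hmono 1 (by norm_num), td⟩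

end Queue

/-! ### Limit of the laws and steady state -/

/-- Turns the mean into a sum of tails, which are monotone along a stochastically increasing
sequence. -/
theorem lintegral_natCast_eq_tsum (μ : Measure ℕ) :
    ∫⁻ w, (w : ℝ≥0∞) ∂μ = ∑' j : ℕ, μ (Set.Ici (j + 1)) := by
  have h : ∀ w : ℕ, (w : ℝ≥0∞) = ∑' j : ℕ, (Set.Ici (j + 1)).indicator 1 w := fun w => by
    rw [tsum_eq_sum (s := Finset.range w)]
    · rw [Finset.sum_congr rfl (g := fun _ => (1 : ℝ≥0∞))]
      · simp
      · intro j hj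
        rw [Set.indicator_of_mem]
        · rfl
        · simpa using hj
    · intro j hj
      rw [Set.indicator_of_notMem]
      simpa using hj
  simp_rw [h]
  rw [lintegral_tsum fun j => Measurable.of_discrete.aemeasurable]
  simp

theorem StochLE.measureReal_Ici_le {μ μ' : Measure ℕ} [IsFiniteMeasure μ'] (h : StochLE μ μ')
    (j : ℕ) : μ.real (Set.Ici j) ≤ μ'.real (Set.Ici j) := by
  refine ENNReal.toReal_mono (measure_ne_top _ _) ?_
  have := h ((Set.Ici j).indicator 1) fun a b hab => by
    by_cases ha : j ≤ a
    · simp [Set.indicator, ha, ha.trans hab]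
    · simp [Set.indicator, ha]
  simpa [lintegral_indicator_one] using this

theorem measureReal_singleton_eq_sub (μ : Measure ℕ) [IsFiniteMeasure μ] (j : ℕ) :
    μ.real {j} = μ.real (Set.Ici j) - μ.real (Set.Ici (j + 1)) := by
  have : Set.Ici j = {j} ∪ Set.Ici (j + 1) := by
    ext i; simp only [Set.mem_Ici, Set.singleton_union, Set.mem_insert_iff]; omega
  rw [this, measureReal_union (by simp) (by measurability)]; ring

/-- A stochastically increasing sequence of laws on `ℕ` with bounded means converges, together
with its means. -/
theorem exists_tendsto_of_stochLE (μ : ℕ → Measure ℕ) [∀ n, IsProbabilityMeasure (μ n)]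
    (hmono : ∀ n, StochLE (μ n) (μ (n + 1))) {m : ℝ}
    (hInt : ∀ n, Integrable (fun w : ℕ => (w : ℝ)) (μ n))
    (hle : ∀ n, ∫ w, (w : ℝ) ∂μ n ≤ m)
    (hm : Tendsto (fun n => ∫ w, (w : ℝ) ∂μ n) atTop (𝓝 m)) :
    ∃ π : Measure ℕ, IsProbabilityMeasure π ∧
      (∀ j, Tendsto (fun n => (μ n).real {j}) atTop (𝓝 (π.real {j}))) ∧
      Integrable (fun w : ℕ => (w : ℝ)) π ∧ ∫ w, (w : ℝ) ∂π = m := by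
  set g : ℕ → ℕ → ℝ := fun j n => (μ n).real (Set.Ici j) with hg
  have gmono : ∀ j, Monotone (g j) := fun j =>
    monotone_nat_of_le_succ fun n => (hmono n).measureReal_Ici_le j
  have gb : ∀ j, BddAbove (Set.range (g j)) := fun j =>
    ⟨1, Set.forall_mem_range.2 fun n => measureReal_le_one⟩
  set G : ℕ → ℝ := fun j => ⨆ n, g j n with hG
  have gt : ∀ j, Tendsto (g j) atTop (𝓝 (G j)) := fun j => tendsto_atTop_ciSup (gmono j) (gb j)
  set p : ℕ → ℝ := fun j => G j - G (j + 1) with hp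
  have pt : ∀ j, Tendsto (fun n => (μ n).real {j}) atTop (𝓝 (p j)) := fun j =>
    ((gt j).sub (gt (j + 1))).congr fun n => (measureReal_singleton_eq_sub _ _).symm
  have p0 : ∀ j, 0 ≤ p j := fun j =>
    ge_of_tendsto' (pt j) fun n => measureReal_nonneg
  have G0 : G 0 = 1 := by
    refine tendsto_nhds_unique (gt 0) ?_
    have : g 0 = fun _ => 1 := by
      funext n
      have : Set.Ici 0 = (Set.univ : Set ℕ) := by ext; simp
      simp [hg, this]
    rw [this]; exact tendsto_const_nhds
  have psum : ∀ J, ∑ j ∈ Finset.range J, p j = 1 - G J := fun J => by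
    rw [← G0]; exact Finset.sum_range_sub' G J
  have m0 : 0 ≤ m := ge_of_tendsto' hm fun n => integral_nonneg fun w => Nat.cast_nonneg _
  -- Markov's inequality, uniform in `n`: no mass escapes to infinity.
  have Gle : ∀ J : ℕ, 0 < J → G J ≤ m / J := fun J hJ => by
    refine le_of_tendsto' (gt J) fun n => ?_
    rw [le_div_iff₀ (by positivity)]
    have := mul_meas_ge_le_integral_of_nonneg (μ := μ n)
      (ae_of_all _ fun w : ℕ => (Nat.cast_nonneg w : (0 : ℝ) ≤ w)) (hInt n) J
    have e : {w : ℕ | (J : ℝ) ≤ w} = Set.Ici J := by ext; simp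
    rw [e] at this
    linarith [hle n]
  have Glim : Tendsto G atTop (𝓝 0) := by
    refine squeeze_zero' (Eventually.of_forall fun J => ?_) ?_
      (tendsto_const_div_atTop_nhds_zero_nat m)
    · exact ge_of_tendsto' (gt J) fun n => measureReal_nonneg
    · exact (eventually_gt_atTop 0).mono Gle
  have hsum : HasSum p 1 := by
    rw [hasSum_iff_tendsto_nat_of_nonneg p0]
    simp_rw [psum]
    simpa using Glim.const_sub 1
  set π : Measure ℕ := Measure.sum (fun n => ENNReal.ofReal (p n) • Measure.dirac n) with hπ
  have hprob : IsProbabilityMeasure π := hsum.isProbabilityMeasure_sum_dirac p0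
  have hsing : ∀ j, π.real {j} = p j := fun j => by
    rw [measureReal_def, hπ, Measure.sum_smul_dirac_singleton, ENNReal.toReal_ofReal (p0 j)]
  have htail : ∀ j, π.real (Set.Ici j) = G j := fun j => by
    induction j with
    | zero =>
      have : Set.Ici 0 = (Set.univ : Set ℕ) := by ext; simp
      simp [G0, this]
    | succ j ih =>
      have := measureReal_singleton_eq_sub π j
      rw [hsing, ih] at this
      simp only [hp] at this
      linarith
  have hlint : ∫⁻ w, (w : ℝ≥0∞) ∂π = ENNReal.ofReal m := by
    -- Monotone convergence for the tails under counting measure, so the mean is not lost in the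
    -- limit.
    have h1 : Tendsto (fun n => ∫⁻ w, (w : ℝ≥0∞) ∂μ n) atTop (𝓝 (∫⁻ w, (w : ℝ≥0∞) ∂π)) := by
      simp_rw [lintegral_natCast_eq_tsum, ← lintegral_count]
      refine lintegral_tendsto_of_tendsto_of_monotone
        (fun n => Measurable.of_discrete.aemeasurable) (ae_of_all _ fun j => ?_)
        (ae_of_all _ fun j => ?_)
      · intro a b hab
        exact (ENNReal.toReal_le_toReal (measure_ne_top _ _) (measure_ne_top _ _)).1
          (gmono (j + 1) hab)
      · rw [← ENNReal.tendsto_toReal_iff (fun n => measure_ne_top _ _) (measure_ne_top _ _)]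
        have := gt (j + 1)
        rwa [← htail] at this
    refine tendsto_nhds_unique h1 (((ENNReal.continuous_ofReal.tendsto m).comp hm).congr fun n => ?_)
    rw [Function.comp, ofReal_integral_eq_lintegral_ofReal (hInt n)
      (ae_of_all _ fun w => Nat.cast_nonneg _)]
    simp
  have hIntπ : Integrable (fun w : ℕ => (w : ℝ)) π := by
    refine ⟨AEStronglyMeasurable.of_discrete, ?_⟩
    rw [hasFiniteIntegral_iff_norm]
    simp [hlint]
  refine ⟨π, hprob, fun j => by rw [hsing]; exact pt j, hIntπ, ?_⟩
  rw [integral_eq_lintegral_of_nonneg_ae (ae_of_all _ fun w => Nat.cast_nonneg _)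
    AEStronglyMeasurable.of_discrete]
  simp [hlint, ENNReal.toReal_ofReal m0]

/-- Only finitely many pairs lead to `j`, since `p.1 + p.2 ≤ j + 1`; point masses therefore pass to
the limit termwise, which yields invariance. -/
theorem queueStep_real_singleton (τ μ : Measure ℕ) [IsFiniteMeasure τ] [IsFiniteMeasure μ]
    (j : ℕ) : (queueStep τ μ).real {j} =
      ∑ p ∈ (Finset.range (j + 2) ×ˢ Finset.range (j + 2)).filter (fun p => p.1 + p.2 - 1 = j),
        μ.real {p.1} * τ.real {p.2} := by
  rw [queueStep, map_measureReal_apply Measurable.of_discrete (measurableSet_singleton j)]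
  have : (fun p : ℕ × ℕ => p.1 + p.2 - 1) ⁻¹' {j} =
      ((Finset.range (j + 2) ×ˢ Finset.range (j + 2)).filter (fun p => p.1 + p.2 - 1 = j) :
        Finset (ℕ × ℕ)) := by
    ext p
    simp only [Set.mem_preimage, Set.mem_singleton_iff, Finset.coe_filter, Finset.mem_product,
      Finset.mem_range, Set.mem_ofPred_eq]
    omega
  rw [this, ← sum_measureReal_singleton]
  refine Finset.sum_congr rfl fun p _ => ?_
  rw [← measureReal_prod_prod, Set.singleton_prod_singleton]

/-- The steady state of a stable queue: it is the limit law of the queue started empty, it is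
invariant, and its mean is given by the Pollaczek–Khinchine formula. -/
theorem exists_steadyState {τ : Measure ℕ} [IsProbabilityMeasure τ]
    (hτ : MemLp (fun t : ℕ => (t : ℝ)) 3 τ)
    {a b : ℝ} (ha : ∫ t, ((t : ℝ) - 1) ^ 1 ∂τ = -a) (ha0 : 0 < a)
    (hb : ∫ t, ((t : ℝ) - 1) ^ 2 ∂τ = b) :
    ∃ π : Measure ℕ, IsProbabilityMeasure π ∧
      (∀ j, Tendsto (fun n => (queueLaw τ n).real {j}) atTop (𝓝 (π.real {j}))) ∧
      queueStep τ π = π ∧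
      Integrable (fun w : ℕ => (w : ℝ)) π ∧ ∫ w, (w : ℝ) ∂π = (b - a) / (2 * a) ∧
      Tendsto (fun n => ∫ w, (w : ℝ) ∂queueLaw τ n) atTop (𝓝 ((b - a) / (2 * a))) := by
  obtain ⟨hm, ht⟩ := tendsto_mean_queueLaw hτ ha ha0 hb
  simp only [pow_one] at hm ht
  have hi : ∀ n, Integrable (fun w : ℕ => (w : ℝ)) (queueLaw τ n) := fun n =>
    (memLp_queueLaw hτ n).integrable (by norm_num)
  obtain ⟨π, hπ, hlim, hInt, hmean⟩ := exists_tendsto_of_stochLE (queueLaw τ)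
    stochLE_queueLaw_succ hi (fun n => hm.ge_of_tendsto ht n) ht
  refine ⟨π, hπ, hlim, ?_, hInt, hmean, ht⟩
  refine Measure.ext_of_singleton fun j => ?_
  rw [← ENNReal.toReal_eq_toReal_iff' (measure_ne_top _ _) (measure_ne_top _ _)]
  -- The shifted sequence has limit `π`, and also `queueStep τ π` by continuity of the step.
  refine tendsto_nhds_unique (f := fun n => (queueLaw τ (n + 1)).real {j}) ?_
    ((hlim j).comp (tendsto_add_atTop_nat 1))
  simp_rw [queueLaw_succ]
  rw [← measureReal_def]
  simp_rw [queueStep_real_singleton]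
  exact tendsto_finsetSum _ fun p _ => (hlim p.1).mul_const _

/-! ### Service and vestige times along a fixed sequence -/

section Deterministic

variable {L : ℝ} {s : ℕ → ℝ}

theorem cumService_succ (s : ℕ → ℝ) (k : ℕ) : cumService s (k + 1) = cumService s k + s k :=
  Finset.sum_range_succ _ _

theorem cumService_mono (hs : ∀ j, 0 ≤ s j) : Monotone (cumService s) :=
  monotone_nat_of_le_succ fun k => by rw [cumService_succ]; linarith [hs k]

theorem serviceTime_eq (hs : ∀ j, 0 ≤ s j) {k : ℕ} (h1 : cumService s k ≤ L)
    (h2 : L < cumService s (k + 1)) : serviceTime L s = k := by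
  refine le_antisymm (Nat.sInf_le h2) (le_csInf ⟨k, h2⟩ fun j hj => ?_)
  by_contra! hjk
  exact absurd (hj.trans_le ((cumService_mono hs hjk).trans h1)) (lt_irrefl _)

theorem measurable_cumService (k : ℕ) : Measurable fun s : ℕ → ℝ => cumService s k := by
  unfold cumService; fun_prop

/-- The second alternative is the default `sInf ∅ = 0`, when the total service never exceeds `L`. -/
theorem serviceTime_eq_iff {k : ℕ} : serviceTime L s = k ↔
    (L < cumService s (k + 1) ∧ ∀ j < k, ¬ L < cumService s (j + 1)) ∨
      (k = 0 ∧ ∀ j, ¬ L < cumService s (j + 1)) := by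
  constructor
  · rintro rfl
    by_cases h : {k : ℕ | L < cumService s (k + 1)}.Nonempty
    · exact Or.inl ⟨Nat.sInf_mem h, fun j hj => Nat.notMem_of_lt_sInf hj⟩
    · rw [Set.not_nonempty_iff_eq_empty] at h
      refine Or.inr ⟨by rw [serviceTime, h, Nat.sInf_empty], fun j hj => ?_⟩
      exact (h ▸ hj : j ∈ (∅ : Set ℕ))
  · rintro (⟨h1, h2⟩ | ⟨rfl, h⟩)
    · refine le_antisymm (Nat.sInf_le h1) (le_csInf ⟨k, h1⟩ fun j hj => ?_)
      by_contra! hjk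
      exact h2 j hjk hj
    · have : {k : ℕ | L < cumService s (k + 1)} = ∅ := Set.eq_empty_of_forall_notMem h
      rw [serviceTime, this, Nat.sInf_empty]

theorem measurable_serviceTime (L : ℝ) : Measurable (serviceTime L) := by
  refine measurable_to_countable' fun k => ?_
  have h : ∀ j, MeasurableSet {s : ℕ → ℝ | L < cumService s (j + 1)} := fun j =>
    measurableSet_lt measurable_const (measurable_cumService _)
  have : serviceTime L ⁻¹' {k} =
      ({s : ℕ → ℝ | L < cumService s (k + 1)} ∩ ⋂ j, ⋂ (_ : j < k),
        {s : ℕ → ℝ | L < cumService s (j + 1)}ᶜ) ∪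
      ({_s : ℕ → ℝ | k = 0} ∩ ⋂ j, {s : ℕ → ℝ | L < cumService s (j + 1)}ᶜ) := by
    ext s
    simp only [Set.mem_preimage, Set.mem_singleton_iff, serviceTime_eq_iff, Set.mem_union,
      Set.mem_inter_iff, Set.mem_iInter, Set.mem_compl_iff, Set.mem_ofPred_eq]
  rw [this]
  exact ((h k).inter (.iInter fun j => .iInter fun _ => (h j).compl)).union
    ((MeasurableSet.const _).inter (.iInter fun j => (h j).compl))

theorem measurable_vestigeTime (L : ℝ) : Measurable (vestigeTime L) := by
  have h : Measurable fun p : ℕ × (ℕ → ℝ) => (L - cumService p.2 p.1) / p.2 p.1 :=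
    measurable_from_prod_countable_right fun k =>
      (measurable_const.sub (measurable_cumService k)).div (measurable_pi_apply k)
  exact h.comp ((measurable_serviceTime L).prodMk measurable_id)

end Deterministic

/-! ### Erlang densities and exponential probabilities -/

/-- Density of the sum of `k + 1` independent exponential variables of rate `r`. -/
noncomputable def erlangPDF (r : ℝ) (k : ℕ) (y : ℝ) : ℝ≥0∞ :=
  (Set.Ici 0).indicator (fun y => ENNReal.ofReal (r ^ (k + 1) * y ^ k / k ! * Real.exp (-(r * y)))) y

theorem measurable_erlangPDF (r : ℝ) (k : ℕ) : Measurable (erlangPDF r k) := by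
  unfold erlangPDF
  exact Measurable.indicator (by fun_prop) measurableSet_Ici

theorem expMeasure_eq_withDensity_erlangPDF (r : ℝ) :
    expMeasure r = volume.withDensity (erlangPDF r 0) := by
  rw [expMeasure, gammaMeasure]
  congr 1
  funext y
  change exponentialPDF r y = _
  rw [exponentialPDF_eq, erlangPDF, Set.indicator]
  simp only [Set.mem_Ici]
  split_ifs <;> simp

/-- The two exponentials combine to a factor independent of `y`, leaving the integral of `y ^ k`
over `[0, z]`. -/
theorem lconvolution_erlangPDF {r : ℝ} (hr : 0 < r) (k : ℕ) :
    erlangPDF r k ⋆ₗ erlangPDF r 0 = erlangPDF r (k + 1) := by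
  funext z
  rw [lconvolution_def]
  have h1 : ∀ y, erlangPDF r k y * erlangPDF r 0 (-y + z) = (Set.Icc 0 z).indicator
      (fun y => ENNReal.ofReal (r ^ (k + 2) / k ! * Real.exp (-(r * z)) * y ^ k)) y := fun y => by
    simp only [erlangPDF, Set.indicator, Set.mem_Ici, Set.mem_Icc]
    by_cases hy : 0 ≤ y
    · by_cases hz : y ≤ z
      · rw [if_pos hy, if_pos (by linarith), if_pos ⟨hy, hz⟩, ← ENNReal.ofReal_mul (by positivity)]
        congr 1
        have : Real.exp (-(r * z)) = Real.exp (-(r * y)) * Real.exp (-(r * (-y + z))) := by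
          rw [← Real.exp_add]; ring_nf
        rw [this]; simp; ring
      · rw [if_neg (c := 0 ≤ -y + z) (by linarith),
          if_neg (fun h : 0 ≤ y ∧ y ≤ z => hz h.2), mul_zero]
    · rw [if_neg hy, if_neg (fun h : 0 ≤ y ∧ y ≤ z => hy h.1), zero_mul]
  simp_rw [h1]
  rw [lintegral_indicator measurableSet_Icc, erlangPDF, Set.indicator]
  simp only [Set.mem_Ici]
  split_ifs with hz
  · rw [← ofReal_integral_eq_lintegral_ofReal, integral_Icc_eq_integral_Ioc,
      ← intervalIntegral.integral_of_le hz, intervalIntegral.integral_const_mul, integral_pow]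
    · congr 1
      rw [Nat.factorial_succ]; push_cast; field_simp; simp
    · exact (Continuous.integrableOn_Icc (by fun_prop))
    · filter_upwards [ae_restrict_mem measurableSet_Icc] with y hy
      have := hy.1
      positivity
  · simp [Set.Icc_eq_empty hz]

/-- The renewal density of a Poisson process is its rate: up to the factor `r` these are Poisson
weights of mean `r * y`. -/
theorem tsum_erlangPDF {r y : ℝ} (hr : 0 < r) (hy : 0 ≤ y) :
    ∑' k, erlangPDF r k y = ENNReal.ofReal r := by
  have h1 : ∀ k, erlangPDF r k y =
      ENNReal.ofReal (r * Real.exp (-(r * y)) * ((r * y) ^ k / k !)) := fun k => by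
    rw [erlangPDF, Set.indicator_of_mem (Set.mem_Ici.2 hy)]
    congr 1; ring
  have h2 : HasSum (fun k : ℕ => r * Real.exp (-(r * y)) * ((r * y) ^ k / k !)) r := by
    have := (NormedSpace.expSeries_div_hasSum_exp (r * y)).mul_left (r * Real.exp (-(r * y)))
    rwa [← Real.exp_eq_exp_ℝ, mul_assoc, ← Real.exp_add, neg_add_cancel, Real.exp_zero,
      mul_one] at this
  simp_rw [h1]
  rw [← ENNReal.ofReal_tsum_of_nonneg (fun k => by positivity) h2.summable, h2.tsum_eq]

section Exp

variable {r : ℝ}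

theorem expMeasure_real_Iic (hr : 0 < r) {a : ℝ} (ha : 0 ≤ a) :
    (expMeasure r).real (Set.Iic a) = 1 - Real.exp (-(r * a)) := by
  have := isProbabilityMeasure_expMeasure hr
  rw [← cdf_eq_real, cdf_expMeasure_eq hr, if_pos ha]

theorem expMeasure_Ioi (hr : 0 < r) {a : ℝ} (ha : 0 ≤ a) :
    expMeasure r (Set.Ioi a) = ENNReal.ofReal (Real.exp (-(r * a))) := by
  have := isProbabilityMeasure_expMeasure hr
  rw [← ofReal_measureReal, ← Set.compl_Iic, probReal_compl_eq_one_sub measurableSet_Iic,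
    expMeasure_real_Iic hr ha, sub_sub_cancel]

theorem expMeasure_Ioo (hr : 0 < r) {a b : ℝ} (ha : 0 ≤ a) (hab : a ≤ b) :
    expMeasure r (Set.Ioo a b) =
      ENNReal.ofReal (Real.exp (-(r * a)) - Real.exp (-(r * b))) := by
  have := isProbabilityMeasure_expMeasure hr
  have hna : NullSingletonClass (expMeasure r) := by
    rw [expMeasure_eq_withDensity_erlangPDF]; infer_instance
  rw [measure_congr Ioo_ae_eq_Ioc, ← ofReal_measureReal, ← sub_sub_sub_cancel_left _ _ 1,
    ← expMeasure_real_Iic hr ha, ← expMeasure_real_Iic hr (ha.trans hab),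
    ← Set.Iic_union_Ioc_eq_Iic hab, measureReal_union (by simp) measurableSet_Ioc,
    add_sub_cancel_left]

theorem expMeasure_Iio_zero (r : ℝ) : expMeasure r (Set.Iio 0) = 0 := by
  rw [expMeasure_eq_withDensity_erlangPDF, withDensity_apply _ measurableSet_Iio,
    setLIntegral_congr_fun (g := fun _ => 0) measurableSet_Iio]
  · simp
  · intro y hy
    exact Set.indicator_of_notMem (by simpa using hy) _

end Exp

/-! ### Laws of the service and vestige times of one packet -/

section Row

/-- The event that exactly `k` blocks are completed. -/
def completes {Ω : Type u} (L : ℝ) (s : ℕ → Ω → ℝ) (k : ℕ) : Set Ω :=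
  {ω | cumService (fun j => s j ω) k ≤ L ∧ L < cumService (fun j => s j ω) (k + 1)}

theorem vestigeTime_eq {Ω : Type u} {L : ℝ} {s : ℕ → Ω → ℝ} {ω : Ω} (h0 : ∀ j, 0 ≤ s j ω) {k : ℕ} (h : ω ∈ completes L s k) :
    vestigeTime L (fun j => s j ω) = (L - cumService (fun j => s j ω) k) / s k ω := by
  rw [vestigeTime, serviceTime_eq h0 h.1 h.2]

variable {Ω : Type u} [MeasurableSpace Ω] {P : Measure Ω} {r L : ℝ} {s : ℕ → Ω → ℝ}

theorem indepFun_cumService (hm : ∀ j, Measurable (s j)) (hi : iIndepFun s P) (k : ℕ) :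
    IndepFun (fun ω => cumService (fun j => s j ω) k) (s k) P := by
  have := hi.indepFun_finsetSum_of_notMem hm (s := Finset.range k) (i := k) (by simp)
  convert this using 1
  funext ω
  simp [cumService]

theorem ae_nonneg_service (hm : ∀ j, Measurable (s j))
    (hl : ∀ j, P.map (s j) = expMeasure r) : ∀ᵐ ω ∂P, ∀ j, 0 ≤ s j ω := by
  rw [ae_all_iff]
  intro j
  have h := expMeasure_Iio_zero r
  rw [← hl j, Measure.map_apply (hm j) measurableSet_Iio] at h
  rw [ae_iff]
  convert h using 2
  ext ω
  simp

theorem aedisjoint_completes (hs : ∀ᵐ ω ∂P, ∀ j, 0 ≤ s j ω) :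
    Pairwise (Function.onFun (AEDisjoint P) (completes L s)) := by
  intro i j hij
  refine measure_eq_zero_iff_ae_notMem.2 ?_
  filter_upwards [hs] with ω h0 h
  exact hij (by rw [← serviceTime_eq h0 h.1.1 h.1.2, serviceTime_eq h0 h.2.1 h.2.2])

variable [IsProbabilityMeasure P]

theorem map_cumService_succ (hr : 0 < r) (hm : ∀ j, Measurable (s j))
    (hl : ∀ j, P.map (s j) = expMeasure r) (hi : iIndepFun s P) (k : ℕ) :
    P.map (fun ω => cumService (fun j => s j ω) (k + 1)) =
      volume.withDensity (erlangPDF r k) := by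
  induction k with
  | zero =>
    rw [← expMeasure_eq_withDensity_erlangPDF, ← hl 0]
    simp [cumService]
  | succ k ih =>
    have hmS : Measurable fun ω => cumService (fun j => s j ω) (k + 1) :=
      (measurable_cumService _).comp (measurable_pi_lambda _ hm)
    have := (indepFun_cumService hm hi (k + 1)).map_add_eq_map_conv_map hmS (hm _)
    rw [ih, hl, expMeasure_eq_withDensity_erlangPDF,
      conv_withDensity_eq_lconvolution (measurable_erlangPDF _ _)
        (measurable_erlangPDF _ _), lconvolution_erlangPDF hr] at this
    rw [← this]
    congr 1
    funext ω
    exact cumService_succ _ _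

theorem measure_cumService_mem (hr : 0 < r) (hm : ∀ j, Measurable (s j))
    (hl : ∀ j, P.map (s j) = expMeasure r) (hi : iIndepFun s P) (k : ℕ)
    {A : Set (ℝ × ℝ)} (hA : MeasurableSet A) :
    P {ω | (cumService (fun j => s j ω) k, s k ω) ∈ A} =
      ∫⁻ y, expMeasure r (Prod.mk y ⁻¹' A) ∂P.map (fun ω => cumService (fun j => s j ω) k) := by
  have := isProbabilityMeasure_expMeasure hr
  have hmS : Measurable fun ω => cumService (fun j => s j ω) k :=
    (measurable_cumService _).comp (measurable_pi_lambda _ hm)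
  have h := (indepFun_iff_map_prod_eq_prod_map_map hmS.aemeasurable
    (hm k).aemeasurable).1 (indepFun_cumService hm hi k)
  rw [← hl k, ← Measure.prod_apply hA, ← h, Measure.map_apply (hmS.prodMk (hm k)) hA]
  rfl

theorem measurableSet_completes (hm : ∀ j, Measurable (s j)) (k : ℕ) :
    MeasurableSet (completes L s k) := by
  have hmS : ∀ k, Measurable fun ω => cumService (fun j => s j ω) k := fun k =>
    (measurable_cumService _).comp (measurable_pi_lambda _ hm)
  exact (measurableSet_le (hmS k) measurable_const).inter
    (measurableSet_lt measurable_const (hmS (k + 1)))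

theorem map_cumService_zero : P.map (fun ω => cumService (fun j => s j ω) 0) =
    Measure.dirac 0 := by
  simp [cumService, Measure.map_const]

/-- Given `S_k = y ≤ L`, the next block overshoots with probability `exp (-(r * (L - y)))`, which
cancels the exponential of the Erlang density. The case `k = 0` is separate because `S_0` is an atom
at `0`. -/
theorem measure_completes (hr : 0 < r) (hL : 0 < L) (hm : ∀ j, Measurable (s j))
    (hl : ∀ j, P.map (s j) = expMeasure r) (hi : iIndepFun s P) (k : ℕ) :
    P (completes L s k) =
      ENNReal.ofReal (Real.exp (-(r * L)) * (r * L) ^ k / k !) := by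
  have hA : MeasurableSet {p : ℝ × ℝ | p.1 ≤ L ∧ L < p.1 + p.2} :=
    (measurableSet_le measurable_fst measurable_const).inter
      (measurableSet_lt measurable_const (measurable_fst.add measurable_snd))
  have h0 : completes L s k = {ω | (cumService (fun j => s j ω) k, s k ω) ∈
      {p : ℝ × ℝ | p.1 ≤ L ∧ L < p.1 + p.2}} := by
    ext ω; simp [completes, cumService_succ]
  have h1 : ∀ y, expMeasure r (Prod.mk y ⁻¹' {p : ℝ × ℝ | p.1 ≤ L ∧ L < p.1 + p.2}) =
      (Set.Iic L).indicator (fun y => ENNReal.ofReal (Real.exp (-(r * (L - y))))) y := fun y => by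
    by_cases hy : y ≤ L
    · rw [Set.indicator_of_mem (Set.mem_Iic.2 hy), ← expMeasure_Ioi hr (sub_nonneg.2 hy)]
      congr 1
      ext z
      simp only [Set.mem_preimage, Set.mem_ofPred_eq, Set.mem_Ioi, hy, true_and, sub_lt_iff_lt_add']
    · rw [Set.indicator_of_notMem (by simpa using hy)]
      simp [hy]
  have hmi : Measurable ((Set.Iic L).indicator
      (fun y => ENNReal.ofReal (Real.exp (-(r * (L - y)))))) :=
    Measurable.indicator (by fun_prop) measurableSet_Iic
  rw [h0, measure_cumService_mem hr hm hl hi k hA]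
  simp_rw [h1]
  cases k with
  | zero =>
    rw [map_cumService_zero, lintegral_dirac' _ hmi, Set.indicator_of_mem (Set.mem_Iic.2 hL.le)]
    simp
  | succ k =>
    rw [map_cumService_succ hr hm hl hi k, lintegral_withDensity_eq_lintegral_mul _
      (measurable_erlangPDF r k) hmi]
    have h2 : ∀ y, (erlangPDF r k * (Set.Iic L).indicator
        (fun y => ENNReal.ofReal (Real.exp (-(r * (L - y)))))) y = (Set.Icc 0 L).indicator
        (fun y => ENNReal.ofReal (r ^ (k + 1) / k ! * Real.exp (-(r * L)) * y ^ k)) y := fun y => by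
      simp only [Pi.mul_apply, erlangPDF, Set.indicator, Set.mem_Ici, Set.mem_Iic, Set.mem_Icc]
      by_cases hy : 0 ≤ y
      · by_cases hz : y ≤ L
        · rw [if_pos hy, if_pos hz, if_pos ⟨hy, hz⟩, ← ENNReal.ofReal_mul (by positivity)]
          congr 1
          have : Real.exp (-(r * L)) = Real.exp (-(r * y)) * Real.exp (-(r * (L - y))) := by
            rw [← Real.exp_add]; ring_nf
          rw [this]; ring
        · rw [if_neg hz, if_neg (fun h : 0 ≤ y ∧ y ≤ L => hz h.2), mul_zero]
      · rw [if_neg hy, if_neg (fun h : 0 ≤ y ∧ y ≤ L => hy h.1), zero_mul]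
    simp_rw [h2]
    rw [lintegral_indicator measurableSet_Icc, ← ofReal_integral_eq_lintegral_ofReal,
      integral_Icc_eq_integral_Ioc,
      ← intervalIntegral.integral_of_le hL.le, intervalIntegral.integral_const_mul, integral_pow]
    · congr 1
      rw [Nat.factorial_succ]; push_cast; field_simp; simp [mul_pow]
    · exact (Continuous.integrableOn_Icc (by fun_prop))
    · filter_upwards [ae_restrict_mem measurableSet_Icc] with y hy
      have := hy.1
      positivity

/-- The Poisson weights of these almost surely disjoint events sum to one; this makes the default
value of `serviceTime` irrelevant. -/
theorem ae_exists_completes (hr : 0 < r) (hL : 0 < L) (hm : ∀ j, Measurable (s j))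
    (hl : ∀ j, P.map (s j) = expMeasure r) (hi : iIndepFun s P) :
    ∀ᵐ ω ∂P, ∃ k, ω ∈ completes L s k := by
  have h1 : P (⋃ k, completes L s k) = 1 := by
    rw [measure_iUnion₀ (aedisjoint_completes (ae_nonneg_service hm hl))
      fun k => (measurableSet_completes hm k).nullMeasurableSet]
    simp_rw [measure_completes hr hL hm hl hi]
    have := hasSum_one_poissonMeasure (r * L).toNNReal
    rw [Real.coe_toNNReal _ (by positivity)] at this
    rw [← ENNReal.ofReal_tsum_of_nonneg (fun k => by positivity) this.summable]
    simpa using congrArg ENNReal.ofReal this.tsum_eq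
  have h2 := (prob_compl_eq_zero_iff
    (MeasurableSet.iUnion fun k => measurableSet_completes (L := L) hm k)).2 h1
  filter_upwards [mem_ae_iff.2 (by rwa [compl_compl] : P ((⋃ k, completes L s k)ᶜᶜᶜ) = 0)] with ω hω
  simpa using hω

/-- The number of complete blocks used by a packet has a Poisson law. -/
theorem map_serviceTime (hr : 0 < r) (hL : 0 < L) (hm : ∀ j, Measurable (s j))
    (hl : ∀ j, P.map (s j) = expMeasure r) (hi : iIndepFun s P) :
    P.map (fun ω => serviceTime L fun j => s j ω) =
      poissonMeasure (r * L).toNNReal := by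
  refine Measure.ext_of_singleton fun k => ?_
  have hmT : Measurable fun ω => serviceTime L fun j => s j ω :=
    (measurable_serviceTime L).comp (measurable_pi_lambda _ hm)
  rw [Measure.map_apply hmT (measurableSet_singleton k), poissonMeasure_singleton,
    Real.coe_toNNReal _ (by positivity)]
  refine (measure_congr ?_).trans (measure_completes hr hL hm hl hi k)
  filter_upwards [ae_nonneg_service hm hl, ae_exists_completes hr hL hm hl hi] with ω h0 ⟨j, hj⟩
  refine propext ⟨fun h => ?_, fun h => serviceTime_eq h0 h.1 h.2⟩
  obtain rfl : k = j := by rw [← serviceTime_eq h0 hj.1 hj.2]; exact Eq.symm h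
  exact hj

theorem ae_vestigeTime_mem (hr : 0 < r) (hL : 0 < L) (hm : ∀ j, Measurable (s j))
    (hl : ∀ j, P.map (s j) = expMeasure r) (hi : iIndepFun s P) :
    ∀ᵐ ω ∂P, 0 ≤ vestigeTime L (fun j => s j ω) ∧ vestigeTime L (fun j => s j ω) < 1 := by
  filter_upwards [ae_nonneg_service hm hl, ae_exists_completes hr hL hm hl hi] with ω h0 ⟨k, hk⟩
  rw [vestigeTime_eq h0 hk]
  have h1 := hk.1
  have h2 := hk.2
  rw [cumService_succ] at h2
  have h3 : 0 < s k ω := by linarith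
  exact ⟨div_nonneg (by linarith) h3.le, (div_lt_one h3).2 (by linarith)⟩

/-- Given `S_k = y ≤ L`, the event reads `L - y < s_k < (L - y) / x`. -/
theorem measure_completes_inter (hr : 0 < r) (hm : ∀ j, Measurable (s j))
    (hl : ∀ j, P.map (s j) = expMeasure r) (hi : iIndepFun s P) {x : ℝ} (hx0 : 0 < x)
    (hx1 : x < 1) (k : ℕ) :
    P (completes L s k ∩ {ω | x * s k ω < L - cumService (fun j => s j ω) k}) =
      ∫⁻ y, (Set.Iic L).indicator (fun y => ENNReal.ofReal
        (Real.exp (-(r * (L - y))) - Real.exp (-(r * ((L - y) / x))))) y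
        ∂P.map (fun ω => cumService (fun j => s j ω) k) := by
  have hA : MeasurableSet {p : ℝ × ℝ | (p.1 ≤ L ∧ L < p.1 + p.2) ∧ x * p.2 < L - p.1} :=
    ((measurableSet_le measurable_fst measurable_const).inter
      (measurableSet_lt measurable_const (measurable_fst.add measurable_snd))).inter
      (measurableSet_lt (measurable_snd.const_mul x) (measurable_fst.const_sub L))
  have h0 : completes L s k ∩ {ω | x * s k ω < L - cumService (fun j => s j ω) k} =
      {ω | (cumService (fun j => s j ω) k, s k ω) ∈
      {p : ℝ × ℝ | (p.1 ≤ L ∧ L < p.1 + p.2) ∧ x * p.2 < L - p.1}} := by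
    ext ω; simp [completes, cumService_succ]
  rw [h0, measure_cumService_mem hr hm hl hi k hA]
  refine lintegral_congr fun y => ?_
  by_cases hy : y ≤ L
  · have hy' := sub_nonneg.2 hy
    rw [Set.indicator_of_mem (Set.mem_Iic.2 hy), ← expMeasure_Ioo hr hy'
      (by rw [le_div_iff₀ hx0]; nlinarith)]
    congr 1
    ext z
    simp only [Set.mem_preimage, Set.mem_ofPred_eq, Set.mem_Ioo, hy, true_and, lt_div_iff₀ hx0,
      sub_lt_iff_lt_add', mul_comm x z]
  · rw [Set.indicator_of_notMem (by simpa using hy)]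
    simp [hy]

theorem integral_exp_neg_mul_sub {c : ℝ} (hc : c ≠ 0) (L : ℝ) :
    ∫ y in (0 : ℝ)..L, Real.exp (-(c * (L - y))) = (1 - Real.exp (-(c * L))) / c := by
  have h : ∀ y ∈ Set.uIcc 0 L, HasDerivAt (fun y => Real.exp (-(c * (L - y))) / c)
      (Real.exp (-(c * (L - y)))) y := fun y _ => by
    have h1 : HasDerivAt (fun y => -(c * (L - y))) c y := by
      have := (((hasDerivAt_id' y).const_sub L).const_mul c).fun_neg
      simpa using this
    have := h1.exp.div_const c
    rwa [mul_div_cancel_right₀ _ hc] at this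
  rw [intervalIntegral.integral_eq_sub_of_hasDerivAt h
    (Continuous.intervalIntegrable (by fun_prop) _ _)]
  simp [sub_div]

/-- Tail of the vestige time. -/
theorem measureReal_lt_vestigeTime (hr : 0 < r) (hL : 0 < L) (hm : ∀ j, Measurable (s j))
    (hl : ∀ j, P.map (s j) = expMeasure r) (hi : iIndepFun s P) {x : ℝ} (hx0 : 0 < x)
    (hx1 : x < 1) :
    P.real {ω | x < vestigeTime L fun j => s j ω} =
      1 - x + (x - 1) * Real.exp (-(r * L) / x) := by
  set F : ℝ → ℝ := fun y => Real.exp (-(r * (L - y))) - Real.exp (-(r * ((L - y) / x))) with hF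
  have hFc : Continuous F := by fun_prop
  have hF0 : ∀ y ≤ L, 0 ≤ F y := fun y hy => by
    rw [hF, sub_nonneg, Real.exp_le_exp, neg_le_neg_iff]
    have : L - y ≤ (L - y) / x := by rw [le_div_iff₀ hx0]; nlinarith
    exact mul_le_mul_of_nonneg_left this hr.le
  have hmi : Measurable ((Set.Iic L).indicator fun y => ENNReal.ofReal (F y)) :=
    Measurable.indicator (by fun_prop) measurableSet_Iic
  have hmS : ∀ k, Measurable fun ω => cumService (fun j => s j ω) k := fun k =>
    (measurable_cumService _).comp (measurable_pi_lambda _ hm)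
  have hterm : ∀ k, P (completes L s k ∩ {ω | x * s k ω < L - cumService (fun j => s j ω) k}) =
      ∫⁻ y, (Set.Iic L).indicator (fun y => ENNReal.ofReal (F y)) y
        ∂P.map (fun ω => cumService (fun j => s j ω) k) :=
    measure_completes_inter hr hm hl hi hx0 hx1
  have hset : {ω | x < vestigeTime L fun j => s j ω} =ᵐ[P]
      ⋃ k, (completes L s k ∩ {ω | x * s k ω < L - cumService (fun j => s j ω) k} : Set Ω) := by
    filter_upwards [ae_nonneg_service hm hl, ae_exists_completes hr hL hm hl hi] with ω h0 ⟨k, hk⟩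
    have key : ∀ k, ω ∈ completes L s k → ((x < vestigeTime L fun j => s j ω) ↔
        x * s k ω < L - cumService (fun j => s j ω) k) := fun k hk => by
      have h1 := hk.1
      have h2 := hk.2
      rw [cumService_succ] at h2
      rw [vestigeTime_eq h0 hk, lt_div_iff₀ (by linarith)]
    refine propext ⟨fun h => ?_, fun h => ?_⟩
    · exact Set.mem_iUnion.2 ⟨k, hk, (key k hk).1 h⟩
    · obtain ⟨j, hj, hj'⟩ := Set.mem_iUnion.1 h
      exact (key j hj).2 hj'
  -- `F 0` comes from `k = 0`, where `S_0 = 0`; for `k ≥ 1` the densities of `S_k` add up to `r`.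
  have hP : P {ω | x < vestigeTime L fun j => s j ω} =
      ENNReal.ofReal (F 0) + ENNReal.ofReal (∫ y in (0 : ℝ)..L, r * F y) := by
    rw [measure_congr hset, measure_iUnion₀]
    · simp_rw [hterm]
      rw [tsum_eq_zero_add' ENNReal.summable]
      simp_rw [map_cumService_succ hr hm hl hi]
      rw [map_cumService_zero, lintegral_dirac' _ hmi,
        Set.indicator_of_mem (Set.mem_Iic.2 hL.le)]
      congr 1
      simp_rw [lintegral_withDensity_eq_lintegral_mul _ (measurable_erlangPDF r _) hmi]
      rw [← lintegral_tsum fun k => ((measurable_erlangPDF r k).mul hmi).aemeasurable,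
        intervalIntegral.integral_of_le hL.le, ← integral_Icc_eq_integral_Ioc,
        ofReal_integral_eq_lintegral_ofReal
          ((Continuous.integrableOn_Icc (by fun_prop)))
          (by filter_upwards [ae_restrict_mem measurableSet_Icc] with y hy
              exact mul_nonneg hr.le (hF0 y hy.2)),
        ← lintegral_indicator measurableSet_Icc]
      refine lintegral_congr fun y => ?_
      simp only [Pi.mul_apply, ENNReal.tsum_mul_right]
      by_cases hy : 0 ≤ y
      · rw [tsum_erlangPDF hr hy]
        by_cases hyL : y ≤ L
        · rw [Set.indicator_of_mem (Set.mem_Iic.2 hyL), Set.indicator_of_mem (Set.mem_Icc.2 ⟨hy, hyL⟩),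
            ENNReal.ofReal_mul hr.le]
        · rw [Set.indicator_of_notMem (by simpa using hyL),
            Set.indicator_of_notMem (fun h => hyL h.2), mul_zero]
      · have : ∀ k, erlangPDF r k y = 0 := fun k =>
          Set.indicator_of_notMem (by simpa using hy) _
        simp only [this, tsum_zero, zero_mul]
        rw [Set.indicator_of_notMem (fun h => hy h.1)]
    · intro i j hij
      exact (aedisjoint_completes (ae_nonneg_service hm hl) hij).mono
        Set.inter_subset_left Set.inter_subset_left
    · intro k
      exact ((measurableSet_completes hm k).inter (measurableSet_lt ((hm k).const_mul x)
        ((hmS k).const_sub L))).nullMeasurableSet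
  have hI : ∫ y in (0 : ℝ)..L, r * F y =
      1 - Real.exp (-(r * L)) - x * (1 - Real.exp (-(r * L) / x)) := by
    have e : ∀ y, Real.exp (-(r * ((L - y) / x))) = Real.exp (-((r / x) * (L - y))) := fun y => by
      congr 1; ring
    simp only [hF, e]
    rw [intervalIntegral.integral_const_mul, intervalIntegral.integral_sub
      (Continuous.intervalIntegrable (by fun_prop) _ _)
      (Continuous.intervalIntegrable (by fun_prop) _ _),
      integral_exp_neg_mul_sub hr.ne', integral_exp_neg_mul_sub (div_pos hr hx0).ne',
      show -(r / x * L) = -(r * L) / x by ring]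
    field_simp
  have hI0 : 0 ≤ ∫ y in (0 : ℝ)..L, r * F y :=
    intervalIntegral.integral_nonneg hL.le fun y hy => mul_nonneg hr.le (hF0 y hy.2)
  rw [measureReal_def, hP, ← ENNReal.ofReal_add (hF0 0 hL.le) hI0,
    ENNReal.toReal_ofReal (add_nonneg (hF0 0 hL.le) hI0), hI]
  simp only [hF, sub_zero, show -(r * (L / x)) = -(r * L) / x by ring]
  ring

theorem integrable_vestigeTime (hr : 0 < r) (hL : 0 < L) (hm : ∀ j, Measurable (s j))
    (hl : ∀ j, P.map (s j) = expMeasure r) (hi : iIndepFun s P) :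
    Integrable (fun ω => vestigeTime L fun j => s j ω) P := by
  refine Integrable.of_bound ((measurable_vestigeTime L).comp
    (measurable_pi_lambda _ hm)).aestronglyMeasurable 1 ?_
  filter_upwards [ae_vestigeTime_mem hr hL hm hl hi] with ω h
  rw [Real.norm_eq_abs, abs_of_nonneg h.1]
  exact h.2.le

theorem integral_vestigeTime (hr : 0 < r) (hL : 0 < L) (hm : ∀ j, Measurable (s j))
    (hl : ∀ j, P.map (s j) = expMeasure r) (hi : iIndepFun s P) :
    ∫ ω, (vestigeTime L fun j => s j ω) ∂P =
      1 / 2 + ∫ x in (0 : ℝ)..1, (x - 1) * Real.exp (-(r * L) / x) := by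
  have hb := ae_vestigeTime_mem hr hL hm hl hi
  rw [(integrable_vestigeTime hr hL hm hl hi).integral_eq_integral_meas_lt
    (hb.mono fun ω h => h.1)]
  have h1 : ∫ t in Set.Ioi 0, P.real {ω | t < vestigeTime L fun j => s j ω} =
      ∫ t in Set.Ioo 0 1, P.real {ω | t < vestigeTime L fun j => s j ω} := by
    refine setIntegral_eq_of_subset_of_forall_sdiff_eq_zero measurableSet_Ioi
      (fun x hx => hx.1) fun x hx => ?_
    have hx1 : 1 ≤ x := not_lt.1 fun h => hx.2 ⟨hx.1, h⟩
    rw [measureReal_def, measure_eq_zero_iff_ae_notMem.2, ENNReal.toReal_zero]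
    filter_upwards [hb] with ω h h'
    exact absurd (h'.trans h.2) (not_lt.2 hx1)
  -- Despite the pole of the exponent at `0`, the integrand is bounded by `1` in absolute value on
  -- `(0, 1]`.
  have hInt : IntervalIntegrable (fun x => (x - 1) * Real.exp (-(r * L) / x)) volume 0 1 := by
    rw [intervalIntegrable_iff_integrableOn_Ioc_of_le zero_le_one]
    refine Measure.integrableOn_of_bounded (M := 1) (by simp)
      (Measurable.aestronglyMeasurable (by fun_prop)) ?_
    filter_upwards [ae_restrict_mem measurableSet_Ioc] with x hx
    have hx0 := hx.1
    rw [norm_mul, Real.norm_eq_abs, Real.norm_eq_abs, Real.abs_exp]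
    refine mul_le_one₀ (abs_le.2 ⟨by linarith, by linarith [hx.2]⟩) (Real.exp_pos _).le ?_
    rw [Real.exp_le_one_iff]
    exact div_nonpos_of_nonpos_of_nonneg (neg_nonpos.2 (by positivity)) hx0.le
  rw [h1, setIntegral_congr_fun measurableSet_Ioo fun x hx =>
    measureReal_lt_vestigeTime hr hL hm hl hi hx.1 hx.2, ← integral_Ioc_eq_integral_Ioo,
    ← intervalIntegral.integral_of_le zero_le_one, intervalIntegral.integral_add
      (Continuous.intervalIntegrable (by fun_prop) _ _) hInt]
  congr 1
  rw [intervalIntegral.integral_sub (by simp) (by simp)]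
  norm_num

end Row

/-! ### Moments of the Poisson law -/

section Poisson

variable (c : ℝ≥0)

theorem poisson_weight_mul_descFactorial (n i : ℕ) :
    Real.exp (-c) * (c : ℝ) ^ (n + i) / (n + i)! * ((n + i).descFactorial i : ℝ) =
      (c : ℝ) ^ i * (Real.exp (-c) * (c : ℝ) ^ n / n !) := by
  have hf : (n ! : ℝ) * ((n + i).descFactorial i : ℝ) = (n + i)! := by
    have := Nat.factorial_mul_descFactorial (Nat.le_add_left i n)
    rw [Nat.add_sub_cancel] at this
    exact_mod_cast this
  have h1 : (n ! : ℝ) ≠ 0 := by positivity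
  have h3 : ((n + i)! : ℝ) ≠ 0 := by positivity
  rw [div_mul_eq_mul_div, div_eq_iff h3, ← hf, pow_add]
  field_simp

/-- The first `i` terms vanish, and shifting the index by `i` turns the rest into `c ^ i` times the
Poisson weights. -/
theorem hasSum_descFactorial_poisson (i : ℕ) :
    HasSum (fun n : ℕ => Real.exp (-c) * (c : ℝ) ^ n / n ! * (n.descFactorial i : ℝ))
      ((c : ℝ) ^ i) := by
  have h := (hasSum_one_poissonMeasure c).mul_left ((c : ℝ) ^ i)
  simp_rw [mul_one, ← poisson_weight_mul_descFactorial c _ i] at h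
  have h0 : ∑ n ∈ Finset.range i,
      Real.exp (-c) * (c : ℝ) ^ n / n ! * (n.descFactorial i : ℝ) = 0 :=
    Finset.sum_eq_zero fun n hn => by
      rw [Nat.descFactorial_of_lt (Finset.mem_range.1 hn), Nat.cast_zero, mul_zero]
  rw [← hasSum_nat_add_iff' i, h0, sub_zero]
  exact h

theorem integrable_descFactorial_poisson (i : ℕ) :
    Integrable (fun n : ℕ => (n.descFactorial i : ℝ)) (poissonMeasure c) := by
  rw [integrable_poissonMeasure_iff]
  simpa using (hasSum_descFactorial_poisson c i).summable

theorem integral_descFactorial_poisson (i : ℕ) :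
    ∫ n, (n.descFactorial i : ℝ) ∂poissonMeasure c = (c : ℝ) ^ i :=
  (hasSum_integral_poissonMeasure (integrable_descFactorial_poisson c i)).unique
    (hasSum_descFactorial_poisson c i)

theorem cast_descFactorial_three (n : ℕ) :
    (n.descFactorial 3 : ℝ) = n * (n - 1) * (n - 2) := by
  rcases n with _ | _ | n
  · simp
  · simp
  · simp [Nat.descFactorial]; ring

theorem cast_descFactorial_two (n : ℕ) : (n.descFactorial 2 : ℝ) = n * (n - 1) := by
  rcases n with _ | n
  · simp
  · simp [Nat.descFactorial]; ring

theorem memLp_three_poisson : MemLp (fun n : ℕ => (n : ℝ)) 3 (poissonMeasure c) := by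
  rw [← integrable_norm_rpow_iff AEStronglyMeasurable.of_discrete (by norm_num) (by norm_num)]
  -- With falling factorials, `n³ = n(n-1)(n-2) + 3n(n-1) + n`.
  have h := ((integrable_descFactorial_poisson c 3).add
    ((integrable_descFactorial_poisson c 2).const_mul 3)).add
    (integrable_descFactorial_poisson c 1)
  refine h.congr (ae_of_all _ fun n => ?_)
  simp only [Pi.add_apply, cast_descFactorial_three, cast_descFactorial_two,
    Nat.descFactorial_one, Real.norm_natCast, ENNReal.toReal_ofNat, Real.rpow_ofNat]
  ring

theorem integrable_natCast_poisson : Integrable (fun n : ℕ => (n : ℝ)) (poissonMeasure c) := by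
  simpa using integrable_descFactorial_poisson c 1

theorem integral_natCast_poisson : ∫ n, (n : ℝ) ∂poissonMeasure c = c := by
  simpa using integral_descFactorial_poisson c 1

theorem integral_sub_one_poisson : ∫ n, ((n : ℝ) - 1) ^ 1 ∂poissonMeasure c = -(1 - (c : ℝ)) := by
  simp_rw [pow_one]
  rw [integral_sub (integrable_natCast_poisson c) (integrable_const _),
    integral_natCast_poisson]
  simp

theorem integral_sub_one_sq_poisson :
    ∫ n, ((n : ℝ) - 1) ^ 2 ∂poissonMeasure c = (c : ℝ) ^ 2 - c + 1 := by
  have h : ∀ n : ℕ, ((n : ℝ) - 1) ^ 2 = (n.descFactorial 2 : ℝ) - n + 1 := fun n => by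
    rw [cast_descFactorial_two]; ring
  simp_rw [h]
  have hi : Integrable (fun n : ℕ => (n.descFactorial 2 : ℝ) - n) (poissonMeasure c) :=
    (integrable_descFactorial_poisson c 2).sub (integrable_natCast_poisson c)
  rw [integral_add hi (integrable_const _), integral_sub (integrable_descFactorial_poisson c 2)
    (integrable_natCast_poisson c), integral_descFactorial_poisson, integral_natCast_poisson]
  simp

end Poisson

/-! ### Pathwise comparison of initial backlogs -/

section Waiting

variable (T : ℕ → ℕ) (w n : ℕ)

theorem waitingTime_zero : waitingTime T w 0 = w := rfl

/-- Lindley's recursion: truncated subtraction is the positive part, and `le_startEpoch` makes the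
subtraction in `waitingTime` exact. -/
theorem waitingTime_succ : waitingTime T w (n + 1) = waitingTime T w n + T n - 1 := by
  have := le_startEpoch T w n
  simp only [waitingTime, startEpoch]
  omega

theorem waitingTime_zero_le : waitingTime T 0 n ≤ waitingTime T w n := by
  induction n with
  | zero => simp [waitingTime_zero]
  | succ n ih => rw [waitingTime_succ, waitingTime_succ]; omega

theorem waitingTime_le_add : waitingTime T w n ≤ waitingTime T 0 n + w := by
  induction n with
  | zero => simp [waitingTime_zero]
  | succ n ih => rw [waitingTime_succ, waitingTime_succ]; omega

/-- As long as the initial backlog is felt, the server has never been idle. -/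
theorem waitingTime_add_eq_of_ne (h : waitingTime T w n ≠ waitingTime T 0 n) :
    waitingTime T w n + n = w + ∑ i ∈ Finset.range n, T i := by
  induction n with
  | zero => simp [waitingTime_zero]
  | succ n ih =>
    have h0 := waitingTime_zero_le T w n
    -- Being different from the empty-start path, the larger path is positive at `n + 1`, so its
    -- last step was not truncated.
    have h1 := waitingTime_zero_le T w (n + 1)
    rw [waitingTime_succ, waitingTime_succ] at h h1
    have := ih (by rintro h2; exact h (by rw [h2]))
    rw [waitingTime_succ, Finset.sum_range_succ]
    omega

theorem waitingTime_congr {T T' : ℕ → ℕ} {n : ℕ} (h : ∀ m < n, T m = T' m) :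
    waitingTime T w n = waitingTime T' w n := by
  induction n with
  | zero => rfl
  | succ n ih =>
    rw [waitingTime_succ, waitingTime_succ, ih fun m hm => h m (by omega), h n (by omega)]

theorem measurable_waitingTime {α : Type*} [MeasurableSpace α] {T : ℕ → α → ℕ} {w : α → ℕ}
    (hT : ∀ m, Measurable (T m)) (hw : Measurable w) (n : ℕ) :
    Measurable fun a => waitingTime (fun m => T m a) (w a) n := by
  induction n with
  | zero => exact hw
  | succ n ih =>
    simp_rw [waitingTime_succ]
    exact (Measurable.of_discrete (f := fun p : ℕ × ℕ => p.1 + p.2 - 1)).comp (ih.prodMk (hT n))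

end Waiting

/-! ### Independence of groups of variables -/

section Independence

variable {Ω : Type u} [MeasurableSpace Ω] {P : Measure Ω}

theorem indepFun_restrict_of_disjoint {ι β : Type*} [MeasurableSpace β] {f : ι → Ω → β}
    (hm : ∀ i, Measurable (f i)) (hf : iIndepFun f P) {A B : Set ι} (hAB : Disjoint A B) :
    IndepFun (fun ω (i : A) => f i ω) (fun ω (i : B) => f i ω) P := by
  have key : ∀ A : Set ι, MeasurableSpace.comap (fun ω (i : A) => f i ω) MeasurableSpace.pi ≤
      ⨆ i ∈ A, MeasurableSpace.comap (f i) inferInstance := fun A => by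
    simp only [MeasurableSpace.pi, MeasurableSpace.comap_iSup, MeasurableSpace.comap_comp]
    refine iSup_le fun i => le_iSup₂_of_le (i : ι) i.2 le_rfl
  rw [IndepFun_iff_Indep]
  exact indep_of_indep_of_le_left (indep_of_indep_of_le_right
    (indep_iSup_of_disjoint (fun i => (hm i).comap_le) hf hAB) (key B)) (key A)

/-- The joint law is a triple product, which may be reassociated. This lets the initial backlog join
the earlier services in being independent of the current ones. -/
theorem indepFun_prodMk_assoc [IsProbabilityMeasure P] {α β γ : Type*} [MeasurableSpace α]
    [MeasurableSpace β] [MeasurableSpace γ] {X : Ω → α} {Y : Ω → β} {Z : Ω → γ}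
    (hX : Measurable X) (hY : Measurable Y) (hZ : Measurable Z)
    (h1 : IndepFun X (fun ω => (Y ω, Z ω)) P) (h2 : IndepFun Y Z P) :
    IndepFun (fun ω => (X ω, Y ω)) Z P := by
  have hXY : IndepFun X Y P := h1.comp measurable_id measurable_fst
  rw [indepFun_iff_map_prod_eq_prod_map_map (by fun_prop) (by fun_prop)] at h1 h2 hXY ⊢
  rw [hXY, ← (MeasurableEquiv.prodAssoc).map_measurableEquiv_injective.eq_iff,
    (measurePreserving_prodAssoc _ _ _).map_eq, ← h2, ← h1,
    Measure.map_map (by fun_prop) (by fun_prop)]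
  rfl

end Independence

/-! ### The stochastic model and its coupling -/

section Model

theorem abs_W_sub_W_empty_le {Ω : Type u} (L : ℝ) (s : ℕ → ℕ → Ω → ℝ) (w₀ : Ω → ℕ) (n : ℕ) (ω : Ω) :
    |(W L s w₀ n ω : ℝ) - (W L s (fun _ => 0) n ω : ℝ)| ≤ (w₀ ω : ℝ) := by
  have h1 : W L s (fun _ => 0) n ω ≤ W L s w₀ n ω := waitingTime_zero_le _ _ _
  have h2 : W L s w₀ n ω ≤ W L s (fun _ => 0) n ω + w₀ ω := waitingTime_le_add _ _ _
  rw [abs_of_nonneg (sub_nonneg.2 (Nat.cast_le.2 h1)), sub_le_iff_le_add']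
  exact_mod_cast h2

variable {Ω : Type u} [MeasurableSpace Ω] {P : Measure Ω} {ν L : ℝ} {s : ℕ → ℕ → Ω → ℝ}
  {w₀ : Ω → ℕ}

namespace IsModel

theorem measurable_T (h : IsModel P ν s w₀) (L : ℝ) (n : ℕ) : Measurable (T L s n) :=
  (measurable_serviceTime L).comp (measurable_pi_lambda _ (h.measurable_service n))

theorem measurable_W (h : IsModel P ν s w₀) (L : ℝ) (n : ℕ) : Measurable (W L s w₀ n) :=
  measurable_waitingTime (h.measurable_T L) h.measurable_init n

theorem iIndepFun_row (h : IsModel P ν s w₀) (n : ℕ) : iIndepFun (s n) P :=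
  h.indep_service.precomp (g := fun j => (n, j)) fun _ _ hij => (Prod.mk.inj hij).2

theorem map_T [IsProbabilityMeasure P] (h : IsModel P ν s w₀) (hν : 0 < ν) (hL : 0 < L) (n : ℕ) :
    P.map (T L s n) = poissonMeasure (L / ν).toNNReal := by
  rw [div_eq_inv_mul]
  exact map_serviceTime (inv_pos.2 hν) hL (h.measurable_service n) (h.law_service n)
    (h.iIndepFun_row n)

theorem indepFun_T (h : IsModel P ν s w₀) {m n : ℕ} (hmn : m ≠ n) :
    IndepFun (T L s m) (T L s n) P := by
  have hd : Disjoint {p : ℕ × ℕ | p.1 = m} {p : ℕ × ℕ | p.1 = n} :=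
    Set.disjoint_left.2 fun p h1 h2 => hmn (Eq.trans (Eq.symm h1) h2)
  have := indepFun_restrict_of_disjoint (fun p : ℕ × ℕ => h.measurable_service p.1 p.2)
    h.indep_service hd
  have hg : ∀ k : ℕ, Measurable fun y : {p : ℕ × ℕ | p.1 = k} → ℝ =>
      serviceTime L fun j => y ⟨(k, j), rfl⟩ := fun k =>
    (measurable_serviceTime L).comp (measurable_pi_lambda _ fun j => measurable_pi_apply _)
  exact this.comp (hg m) (hg n)

/-- `W_n` is a function of `w₀` and the rows before `n`, whereas `T_n` depends on row `n` alone. -/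
theorem indepFun_W_T [IsProbabilityMeasure P] (h : IsModel P ν s w₀) (n : ℕ) :
    IndepFun (W L s w₀ n) (T L s n) P := by
  have hd : Disjoint {p : ℕ × ℕ | p.1 < n} {p : ℕ × ℕ | p.1 = n} :=
    Set.disjoint_left.2 fun p h1 h2 => absurd (Eq.symm h2) (Nat.ne_of_gt h1)
  have hs : ∀ p : ℕ × ℕ, Measurable (s p.1 p.2) := fun p => h.measurable_service p.1 p.2
  have h2 := indepFun_restrict_of_disjoint hs h.indep_service hd
  have hm : ∀ A : Set (ℕ × ℕ), Measurable fun ω (p : A) => s p.1.1 p.1.2 ω := fun A =>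
    measurable_pi_lambda _ fun p => hs p
  have h1 : IndepFun w₀ (fun ω => ((fun (p : {p : ℕ × ℕ | p.1 < n}) => s p.1.1 p.1.2 ω),
      (fun (p : {p : ℕ × ℕ | p.1 = n}) => s p.1.1 p.1.2 ω))) P :=
    h.indep_init.comp measurable_id
      (ψ := fun y : ℕ × ℕ → ℝ => ((fun (p : {p : ℕ × ℕ | p.1 < n}) => y p.1),
        (fun (p : {p : ℕ × ℕ | p.1 = n}) => y p.1))) (by fun_prop)
  have h3 := indepFun_prodMk_assoc h.measurable_init (hm _) (hm _) h1 h2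
  -- Extension of the past rows by zero; the added rows do not affect the waiting time at `n`.
  let E : ({p : ℕ × ℕ | p.1 < n} → ℝ) → ℕ → ℕ → ℝ := fun y i j =>
    if hi : i < n then y ⟨(i, j), hi⟩ else 0
  have hE : ∀ i j, Measurable fun y => E y i j := fun i j => by
    by_cases hi : i < n
    · simp only [E, hi, dif_pos]; fun_prop
    · simp only [E, hi, dif_neg, not_false_iff]; fun_prop
  have hG : Measurable fun q : ℕ × ({p : ℕ × ℕ | p.1 < n} → ℝ) =>
      waitingTime (fun m => serviceTime L (E q.2 m)) q.1 n :=
    measurable_waitingTime (fun m => (measurable_serviceTime L).comp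
      (measurable_pi_lambda _ fun j => (hE m j).comp measurable_snd)) measurable_fst n
  have hH : Measurable fun y : {p : ℕ × ℕ | p.1 = n} → ℝ =>
      serviceTime L fun j => y ⟨(n, j), rfl⟩ :=
    (measurable_serviceTime L).comp (measurable_pi_lambda _ fun j => measurable_pi_apply _)
  have h4 := h3.comp hG hH
  refine h4.congr (ae_of_all _ fun ω => ?_) (ae_of_all _ fun ω => rfl)
  refine waitingTime_congr _ fun m hm => ?_
  simp only [E, hm, dif_pos]
  rfl

theorem map_W_succ [IsProbabilityMeasure P] (h : IsModel P ν s w₀) (hν : 0 < ν) (hL : 0 < L)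
    (n : ℕ) :
    P.map (W L s w₀ (n + 1)) =
      queueStep (poissonMeasure (L / ν).toNNReal) (P.map (W L s w₀ n)) := by
  rw [queueStep, ← h.map_T hν hL n, ← (indepFun_iff_map_prod_eq_prod_map_map
    (h.measurable_W L n).aemeasurable (h.measurable_T L n).aemeasurable).1 (h.indepFun_W_T n),
    Measure.map_map Measurable.of_discrete ((h.measurable_W L n).prodMk (h.measurable_T L n))]
  congr 1
  funext ω
  exact waitingTime_succ _ _ _

/-- Provides the coupling partner: the same services on the same space, with an empty start. -/
theorem empty [IsProbabilityMeasure P] (h : IsModel P ν s w₀) : IsModel P ν s (fun _ => 0) :=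
  { h with
    measurable_init := measurable_const
    indep_init := indepFun_const_left _ _ }

theorem map_W_empty [IsProbabilityMeasure P] (h : IsModel P ν s w₀) (hν : 0 < ν) (hL : 0 < L)
    (n : ℕ) :
    P.map (W L s (fun _ => 0) n) = queueLaw (poissonMeasure (L / ν).toNNReal) n := by
  induction n with
  | zero =>
    change P.map (fun _ => 0) = Measure.dirac 0
    simp [Measure.map_const]
  | succ n ih => rw [h.empty.map_W_succ hν hL, ih, queueLaw_succ]

theorem integrable_T [IsProbabilityMeasure P] (h : IsModel P ν s w₀) (hν : 0 < ν) (hL : 0 < L)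
    (n : ℕ) : Integrable (fun ω => (T L s n ω : ℝ)) P := by
  have := integrable_natCast_poisson (L / ν).toNNReal
  rw [← h.map_T hν hL n] at this
  exact this.comp_measurable (h.measurable_T L n)

theorem integral_T [IsProbabilityMeasure P] (h : IsModel P ν s w₀) (hν : 0 < ν) (hL : 0 < L)
    (n : ℕ) : ∫ ω, (T L s n ω : ℝ) ∂P = L / ν := by
  have := integral_natCast_poisson (L / ν).toNNReal
  rw [← h.map_T hν hL n, integral_map (h.measurable_T L n).aemeasurable
    AEStronglyMeasurable.of_discrete, Real.coe_toNNReal _ (by positivity)] at this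
  exact this

/-- In a stable queue the initial backlog is eventually forgotten. -/
theorem ae_eventually_W_eq [IsProbabilityMeasure P] (h : IsModel P ν s w₀) (hν : 0 < ν)
    (hL : 0 < L) (hst : L / ν < 1) :
    ∀ᵐ ω ∂P, ∀ᶠ n in atTop, W L s w₀ n ω = W L s (fun _ => 0) n ω := by
  have hcast : Measurable (Nat.cast : ℕ → ℝ) := Measurable.of_discrete
  have hsl := strong_law_ae_real (μ := P) (fun n ω => (T L s n ω : ℝ)) (h.integrable_T hν hL 0)
    (fun i j hij => (h.indepFun_T hij).comp hcast hcast)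
    (fun i => IdentDistrib.comp ⟨(h.measurable_T L i).aemeasurable,
      (h.measurable_T L 0).aemeasurable, by rw [h.map_T hν hL, h.map_T hν hL]⟩ hcast)
  filter_upwards [hsl] with ω hω
  rw [h.integral_T hν hL] at hω
  have h1 := (tendsto_const_div_atTop_nhds_zero_nat (w₀ ω : ℝ)).add hω
  rw [zero_add] at h1
  filter_upwards [h1.eventually_lt_const hst, eventually_gt_atTop 0] with n hn hn0
  by_contra hne
  -- Without merging, `w₀ + ∑ T_i = W_n + n ≥ n`, although the average of the left side tends to `L
  -- / ν < 1`.
  have h2 := waitingTime_add_eq_of_ne (fun m => T L s m ω) (w₀ ω) n hne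
  rw [← add_div, div_lt_one (by positivity)] at hn
  have h3 : w₀ ω + ∑ i ∈ Finset.range n, T L s i ω < n := by exact_mod_cast hn
  omega

/-- Used with `F` an indicator for convergence of the laws, and with `F` the identity, dominated by
`w₀`, for the means. -/
theorem tendsto_integral_W_sub [IsProbabilityMeasure P] (h : IsModel P ν s w₀) (hν : 0 < ν)
    (hL : 0 < L) (hst : L / ν < 1) (F : ℕ → ℝ) {b : Ω → ℝ} (hb : Integrable b P)
    (hF : ∀ n ω, |F (W L s w₀ n ω) - F (W L s (fun _ => 0) n ω)| ≤ b ω) :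
    Tendsto (fun n => ∫ ω, (F (W L s w₀ n ω) - F (W L s (fun _ => 0) n ω)) ∂P) atTop (𝓝 0) := by
  have hFm : Measurable F := Measurable.of_discrete
  rw [← integral_zero Ω ℝ (μ := P)]
  refine tendsto_integral_of_dominated_convergence b
    (fun n => ((hFm.comp (h.measurable_W L n)).sub
      (hFm.comp (h.empty.measurable_W L n))).aestronglyMeasurable) hb
    (fun n => ae_of_all _ (hF n)) ?_
  filter_upwards [h.ae_eventually_W_eq hν hL hst] with ω hω
  refine tendsto_const_nhds.congr' ?_
  filter_upwards [hω] with n hn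
  rw [hn, sub_self]

theorem integrable_V [IsProbabilityMeasure P] (h : IsModel P ν s w₀) (hν : 0 < ν) (hL : 0 < L)
    (n : ℕ) : Integrable (V L s n) P :=
  integrable_vestigeTime (inv_pos.2 hν) hL (h.measurable_service n) (h.law_service n)
    (h.iIndepFun_row n)

theorem integral_V [IsProbabilityMeasure P] (h : IsModel P ν s w₀) (hν : 0 < ν) (hL : 0 < L)
    (n : ℕ) : ∫ ω, V L s n ω ∂P =
      1 / 2 + ∫ x in (0 : ℝ)..1, (x - 1) * Real.exp (-(L / ν) / x) := by
  rw [div_eq_inv_mul L ν]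
  exact integral_vestigeTime (inv_pos.2 hν) hL (h.measurable_service n) (h.law_service n)
    (h.iIndepFun_row n)

theorem integrable_W_empty [IsProbabilityMeasure P] (h : IsModel P ν s w₀) (hν : 0 < ν)
    (hL : 0 < L) (n : ℕ) : Integrable (fun ω => (W L s (fun _ => 0) n ω : ℝ)) P := by
  have := (memLp_queueLaw (memLp_three_poisson (L / ν).toNNReal) n).integrable (by norm_num)
  rw [← h.map_W_empty hν hL n] at this
  exact this.comp_measurable (h.empty.measurable_W L n)

theorem integrable_W [IsProbabilityMeasure P] (h : IsModel P ν s w₀) (hν : 0 < ν)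
    (hL : 0 < L) (hw : Integrable (fun ω => (w₀ ω : ℝ)) P) (n : ℕ) :
    Integrable (fun ω => (W L s w₀ n ω : ℝ)) P := by
  have hcast : Measurable (Nat.cast : ℕ → ℝ) := Measurable.of_discrete
  refine ((h.integrable_W_empty hν hL n).add hw).mono'
    (hcast.comp (h.measurable_W L n)).aestronglyMeasurable (ae_of_all _ fun ω => ?_)
  have h2 : W L s w₀ n ω ≤ W L s (fun _ => 0) n ω + w₀ ω := waitingTime_le_add _ _ _
  simp only [Real.norm_natCast, Pi.add_apply]
  exact_mod_cast h2

end IsModel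

end Model

end BlockFading

/-! ### Assembly of the delay formula -/

theorem theorem3 (L ν θ : ℝ) (hL : 0 < L) (hν : 0 < ν) (hθ : θ = L / ν) (hstable : θ < 1) :
    ∃ π : Measure ℕ, IsProbabilityMeasure π ∧
      ∀ (Ω : Type u) [MeasurableSpace Ω] (P : Measure Ω) [IsProbabilityMeasure P]
        (s : ℕ → ℕ → Ω → ℝ) (w₀ : Ω → ℕ), BlockFading.IsModel P ν s w₀ →
        -- `π` is the limit distribution of the waiting time, whatever the initial backlog
        (∀ j : ℕ, Tendsto (fun n => P.real {ω | BlockFading.W L s w₀ n ω = j}) atTop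
          (𝓝 (π.real {j}))) ∧
        -- the system in steady state
        (P.map w₀ = π → ∀ n : ℕ,
          P.map (BlockFading.W L s w₀ n) = π ∧
          (Integrable (fun ω => (BlockFading.T L s n ω : ℝ) + (BlockFading.W L s w₀ n ω : ℝ)) P ∧
            ∫ ω, ((BlockFading.T L s n ω : ℝ) + (BlockFading.W L s w₀ n ω : ℝ)) ∂P
              = θ + θ ^ 2 / (2 * (1 - θ))) ∧
          (Integrable (BlockFading.V L s n) P ∧
            ∫ ω, BlockFading.V L s n ω ∂P
              = 1 / 2 + ∫ x in (0 : ℝ)..1, (x - 1) * Real.exp (-θ / x)) ∧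
          (Integrable (BlockFading.D L s w₀ n) P ∧
            ∫ ω, BlockFading.D L s w₀ n ω ∂P
              = 1 / 2 + θ + θ ^ 2 / (2 * (1 - θ))
                + ∫ x in (0 : ℝ)..1, (x - 1) * Real.exp (-θ / x))) ∧
        -- the long-run mean delay for every initial backlog with finite mean
        (Integrable (fun ω => (w₀ ω : ℝ)) P →
          (∀ n : ℕ, Integrable (BlockFading.D L s w₀ n) P) ∧
          Tendsto (fun n => ∫ ω, BlockFading.D L s w₀ n ω ∂P) atTop
            (𝓝 (1 / 2 + θ + θ ^ 2 / (2 * (1 - θ))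
                + ∫ x in (0 : ℝ)..1, (x - 1) * Real.exp (-θ / x)))) := by
  have hθ0 : 0 < θ := hθ ▸ div_pos hL hν
  have hc : ((L / ν).toNNReal : ℝ) = θ := by rw [← hθ, Real.coe_toNNReal _ hθ0.le]
  have ha := BlockFading.integral_sub_one_poisson (L / ν).toNNReal
  have hb := BlockFading.integral_sub_one_sq_poisson (L / ν).toNNReal
  rw [hc] at ha hb
  obtain ⟨π, hπ, hlim, hstat, hInt, hmean, hmlim⟩ := BlockFading.exists_steadyState
    (BlockFading.memLp_three_poisson (L / ν).toNNReal) ha (sub_pos.2 hstable) hb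
  -- The Poisson moments give `a = 1 - θ` and `b = θ ^ 2 - θ + 1`, hence `b - a = θ ^ 2`.
  rw [show θ ^ 2 - θ + 1 - (1 - θ) = θ ^ 2 by ring] at hmean hmlim
  refine ⟨π, hπ, fun Ω _ P _ s w₀ h => ?_⟩
  have hst : L / ν < 1 := hθ ▸ hstable
  have hIT := h.integrable_T hν hL
  have hET : ∀ n, ∫ ω, (BlockFading.T L s n ω : ℝ) ∂P = θ := fun n => hθ ▸ h.integral_T hν hL n
  have hIV := h.integrable_V hν hL
  have hEV : ∀ n, ∫ ω, BlockFading.V L s n ω ∂P =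
      1 / 2 + ∫ x in (0 : ℝ)..1, (x - 1) * Real.exp (-θ / x) := fun n => by
    rw [hθ]; exact h.integral_V hν hL n
  have hID : ∀ n, Integrable (fun ω => (BlockFading.W L s w₀ n ω : ℝ)) P →
      Integrable (BlockFading.D L s w₀ n) P ∧ ∫ ω, BlockFading.D L s w₀ n ω ∂P =
        θ + ∫ ω, (BlockFading.W L s w₀ n ω : ℝ) ∂P +
          (1 / 2 + ∫ x in (0 : ℝ)..1, (x - 1) * Real.exp (-θ / x)) := fun n hW => by
    refine ⟨((hIT n).add hW).add (hIV n), ?_⟩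
    rw [← hEV n, ← hET n, ← integral_add (hIT n) hW, ← integral_add ((hIT n).fun_add hW) (hIV n)]
    rfl
  refine ⟨fun j => ?_, fun hw n => ?_, fun hw => ?_⟩
  · set F : ℕ → ℝ := ({j} : Set ℕ).indicator 1 with hF
    have hFb : ∀ k, 0 ≤ F k ∧ F k ≤ 1 := fun k => by
      by_cases hk : k = j <;> simp [hF, hk]
    have hFI : ∀ w : Ω → ℕ, Measurable w → Integrable (fun ω => F (w ω)) P ∧
        ∫ ω, F (w ω) ∂P = P.real {ω | w ω = j} := fun w hwm => by
      have hset : MeasurableSet {ω | w ω = j} := hwm (measurableSet_singleton j)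
      have e : (fun ω => F (w ω)) = {ω | w ω = j}.indicator 1 := rfl
      rw [e, integral_indicator_one hset]
      exact ⟨(integrable_const (1 : ℝ)).indicator hset, rfl⟩
    have h1 := h.tendsto_integral_W_sub hν hL hst F (integrable_const (1 : ℝ)) fun n ω =>
      abs_le.2 ⟨by linarith [(hFb (BlockFading.W L s w₀ n ω)).1,
        (hFb (BlockFading.W L s (fun _ => 0) n ω)).2],
        by linarith [(hFb (BlockFading.W L s w₀ n ω)).2,
        (hFb (BlockFading.W L s (fun _ => 0) n ω)).1]⟩
    have h2 := h1.add (hlim j)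
    rw [zero_add] at h2
    refine h2.congr fun n => ?_
    obtain ⟨i1, e1⟩ := hFI _ (h.measurable_W L n)
    obtain ⟨i2, e2⟩ := hFI _ (h.empty.measurable_W L n)
    rw [integral_sub i1 i2, e1, e2, ← h.map_W_empty hν hL n,
      map_measureReal_apply (h.empty.measurable_W L n) (measurableSet_singleton j)]
    exact sub_add_cancel _ _
  · have hlaw : ∀ n, P.map (BlockFading.W L s w₀ n) = π := fun n => by
      induction n with
      | zero => exact hw
      | succ n ih => rw [h.map_W_succ hν hL, ih, hstat]
    have hIW : Integrable (fun ω => (BlockFading.W L s w₀ n ω : ℝ)) P := by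
      rw [← hlaw n] at hInt
      exact hInt.comp_measurable (h.measurable_W L n)
    have hEW : ∫ ω, (BlockFading.W L s w₀ n ω : ℝ) ∂P = θ ^ 2 / (2 * (1 - θ)) := by
      rw [← hmean, ← hlaw n, integral_map (h.measurable_W L n).aemeasurable
        AEStronglyMeasurable.of_discrete]
    refine ⟨hlaw n, ⟨(hIT n).add hIW, ?_⟩, ⟨hIV n, hEV n⟩, (hID n hIW).1, ?_⟩
    · rw [integral_add (hIT n) hIW, hET, hEW]
    · rw [(hID n hIW).2, hEW]; ring
  · have hIW := h.integrable_W hν hL hw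
    refine ⟨fun n => (hID n (hIW n)).1, ?_⟩
    have h1 := h.tendsto_integral_W_sub hν hL hst (fun k => (k : ℝ)) hw
      (BlockFading.abs_W_sub_W_empty_le L s w₀)
    have h2 := ((h1.add hmlim).const_add θ).add_const
      (1 / 2 + ∫ x in (0 : ℝ)..1, (x - 1) * Real.exp (-θ / x))
    rw [show 1 / 2 + θ + θ ^ 2 / (2 * (1 - θ)) + ∫ x in (0 : ℝ)..1, (x - 1) * Real.exp (-θ / x) =
      θ + (0 + θ ^ 2 / (2 * (1 - θ))) +
        (1 / 2 + ∫ x in (0 : ℝ)..1, (x - 1) * Real.exp (-θ / x)) by ring]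
    refine h2.congr fun n => ?_
    rw [(hID n (hIW n)).2, integral_sub (hIW n) (h.integrable_W_empty hν hL n),
      ← h.map_W_empty hν hL n, integral_map (h.empty.measurable_W L n).aemeasurable
        AEStronglyMeasurable.of_discrete, sub_add_cancel]
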